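/- Let $(X,\|\cdot\|)$ be a Banach space, $a<b$ real, $\alpha>0$ with $\alpha\notin\mathbb N$, $N=\lceil\alpha\rceil$, $f\in C^N([a,b],X)$, $0<\beta<1$ and $m\in\mathbb N$, $m\ge 1$. Put $$\varphi(x)=\frac{x}{\sqrt[2m]{1+x^{2m}}},\qquad \Phi(x)=\tfrac14\left[\varphi(x+1)-\varphi(x-1)\right],$$ and, for $n\in\mathbb N$ with $\lceil na\rceil\le\lfloor nb\rfloor$, $x\in[a,b]$ and $g:[a,b]\to X$ or $g:[a,b]\to\mathbb R$, $$A_n(g,x)=A_n(g)(x)=\frac{\sum_{k=\lceil na\rceil}^{\lfloor nb\rfloor}g\left(\frac kn\right)\Phi(nx-k)}{\sum_{k=\lceil na\rceil}^{\lfloor nb\rfloor}\Phi(nx-k)}.$$ For $x\in[a,b]$ let $$D_{*x}^\alpha f(y)=\frac1{\Gamma(N-\alpha)}\int_x^y(y-t)^{N-\alpha-1}f^{(N)}(t)\,dt\quad(y\in[x,b]),$$ $$D_{x-}^\alpha f(y)=\frac{(-1)^N}{\Gamma(N-\alpha)}\int_y^x(z-y)^{N-\alpha-1}f^{(N)}(z)\,dz\quad(y\in[a,x])$$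 be the left and right Caputo–Bochner fractional derivatives (Bochner integrals). On an interval $[c,d]$ write $\omega_1(g,\delta)_{[c,d]}=\sup\{\|g(u)-g(v)\|:u,v\in[c,d],\ |u-v|\le\delta\}$ and $\|g\|_{\infty,[c,d]}=\sup_{[c,d]}\|g\|$, with $\|\cdot\|_\infty=\|\cdot\|_{\infty,[a,b]}$. For $n$ with $n^{1-\beta}>2$ put $$R_n(x)=\frac{\omega_1\left(D_{x-}^\alpha f,\frac1{n^\beta}\right)_{[a,x]}+\omega_1\left(D_{*x}^\alpha f,\frac1{n^\beta}\right)_{[x,b]}}{n^{\alpha\beta}}+\frac{\|D_{x-}^\alpha f\|_{\infty,[a,x]}(x-a)^\alpha+\|D_{*x}^\alpha f\|_{\infty,[x,b]}(b-x)^\alpha}{4m(n^{1-\beta}-2)^{2m}}.$$ Then $D_{x-}^\alpha f$ on $[a,x]$ and $D_{*x}^\alpha f$ on $[x,b]$ are bounded uniformly in $x\in[a,b]$ (so that all suprema here and below are finite), and for every $n\in\mathbb N$ with $n^{1-\beta}>2$ and $\lceil na\rceil\le\lfloor nb\rfloor$, where sums $\sum_{j=1}^{N-1}$ are $0$ for $N=1$: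 (i) for all $x\in[a,b]$, $$\left\|A_n(f,x)-\sum_{j=1}^{N-1}\frac{f^{(j)}(x)}{j!}A_n\left((\cdot-x)^j\right)(x)-f(x)\right\|\le\frac{2\sqrt[2m]{1+4^m}}{\Gamma(\alpha+1)}R_n(x);$$ (ii) if $x\in[a,b]$ and $f^{(j)}(x)=0$ for $j=1,\dots,N-1$, then $$\|A_n(f,x)-f(x)\|\le\frac{2\sqrt[2m]{1+4^m}}{\Gamma(\alpha+1)}R_n(x);$$ (iii) for all $x\in[a,b]$, $$\|A_n(f,x)-f(x)\|\le2\sqrt[2m]{1+4^m}\left\{\sum_{j=1}^{N-1}\frac{\|f^{(j)}(x)\|}{j!}\left\{\frac1{n^{\beta j}}+\frac{(b-a)^j}{4m(n^{1-\beta}-2)^{2m}}\right\}+\frac{R_n(x)}{\Gamma(\alpha+1)}\right\};$$ (iv) $A_nf-f$ is bounded on $[a,b]$ and $$\|A_nf-f\|_\infty\le2\sqrt[2m]{1+4^m}\Bigg\{\sum_{j=1}^{N-1}\frac{\|f^{(j)}\|_\infty}{j!}\left\{\frac1{n^{\beta j}}+\frac{(b-a)^j}{4m(n^{1-\beta}-2)^{2m}}\right\}$$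 $$+\frac1{\Gamma(\alpha+1)}\Bigg\{\frac{\sup_{x\in[a,b]}\omega_1\left(D_{x-}^\alpha f,\frac1{n^\beta}\right)_{[a,x]}+\sup_{x\in[a,b]}\omega_1\left(D_{*x}^\alpha f,\frac1{n^\beta}\right)_{[x,b]}}{n^{\alpha\beta}}$$ $$+\frac{(b-a)^\alpha}{4m(n^{1-\beta}-2)^{2m}}\left(\sup_{x\in[a,b]}\|D_{x-}^\alpha f\|_{\infty,[a,x]}+\sup_{x\in[a,b]}\|D_{*x}^\alpha f\|_{\infty,[x,b]}\right)\Bigg\}\Bigg\}.$$ Moreover, as $n\to\infty$, the right-hand side of (iii) tends to $0$ for every $x\in[a,b]$ and the right-hand side of (iv) tends to $0$; hence $A_n(f,x)\to f(x)$ for every $x\in[a,b]$, and $A_nf\to f$ uniformly on $[a,b]$. -/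

import Mathlib

open Filter Topology
open scoped Nat

noncomputable section

/-- The algebraic sigmoidal function `φ(x) = x / (1 + x^{2m})^{1/(2m)}`. -/
def algSigmoid (m : ℕ) (x : ℝ) : ℝ :=
  x / (1 + x ^ (2 * m)) ^ (1 / (2 * (m : ℝ)))

/-- The bell-shaped density `Φ(x) = (φ(x + 1) - φ(x - 1)) / 4`. -/
def algDensity (m : ℕ) (x : ℝ) : ℝ :=
  (1 / 4) * (algSigmoid m (x + 1) - algSigmoid m (x - 1))

/-- The neural network operator
`A_n(f, x) = (∑_{k=⌈na⌉}^{⌊nb⌋} Φ(nx - k) f(k/n)) / (∑_{k=⌈na⌉}^{⌊nb⌋} Φ(nx - k))`,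
for functions with values in a real vector space; it is meaningful when `⌈na⌉ ≤ ⌊nb⌋`. -/
def neuralOp {V : Type*} [AddCommGroup V] [Module ℝ V]
    (m : ℕ) (a b : ℝ) (n : ℕ) (f : ℝ → V) (x : ℝ) : V :=
  (∑ k ∈ Finset.Icc ⌈(n : ℝ) * a⌉ ⌊(n : ℝ) * b⌋, algDensity m ((n : ℝ) * x - (k : ℝ)))⁻¹ •
    ∑ k ∈ Finset.Icc ⌈(n : ℝ) * a⌉ ⌊(n : ℝ) * b⌋,
      algDensity m ((n : ℝ) * x - (k : ℝ)) • f ((k : ℝ) / (n : ℝ))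

/-- The first modulus of continuity `ω₁(g, δ)` of `g` on the interval `[c, d]`. -/
def modCont {V : Type*} [NormedAddCommGroup V] (g : ℝ → V) (δ c d : ℝ) : ℝ :=
  sSup {r : ℝ | ∃ u ∈ Set.Icc c d, ∃ v ∈ Set.Icc c d, |u - v| ≤ δ ∧ r = ‖g u - g v‖}

/-- The sup norm of `g` on the interval `[c, d]`. -/
def supNormOn {V : Type*} [NormedAddCommGroup V] (g : ℝ → V) (c d : ℝ) : ℝ :=
  sSup ((fun y => ‖g y‖) '' Set.Icc c d)

section Caputo

variable {X : Type*} [NormedAddCommGroup X] [NormedSpace ℝ X]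

/-- The left Caputo–Bochner derivative `D_{*x}^α f (y)` of non-integer order `α > 0`, `N = ⌈α⌉`, of
a function `f` on `[a, b]`, based at `x ∈ [a, b]`; by convention it vanishes for `y < x`. -/
def caputoLeft (a b α : ℝ) (f : ℝ → X) (x y : ℝ) : X :=
  if x ≤ y then
    (1 / Real.Gamma ((⌈α⌉₊ : ℝ) - α)) •
      ∫ t in x..y, (y - t) ^ ((⌈α⌉₊ : ℝ) - α - 1) • iteratedDerivWithin ⌈α⌉₊ f (Set.Icc a b) t
  else 0

/-- The right Caputo–Bochner derivative `D_{x-}^α f (y)` of non-integer order `α > 0`, `N = ⌈α⌉`, of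
a function `f` on `[a, b]`, based at `x ∈ [a, b]`; by convention it vanishes for `y > x`. -/
def caputoRight (a b α : ℝ) (f : ℝ → X) (x y : ℝ) : X :=
  if y ≤ x then
    ((-1) ^ ⌈α⌉₊ / Real.Gamma ((⌈α⌉₊ : ℝ) - α)) •
      ∫ z in y..x, (z - y) ^ ((⌈α⌉₊ : ℝ) - α - 1) • iteratedDerivWithin ⌈α⌉₊ f (Set.Icc a b) z
  else 0

/-- The quantity
`(ω₁(D_{x-}^α f, n^{-β})_{[a,x]} + ω₁(D_{*x}^α f, n^{-β})_{[x,b]}) / n^{αβ}`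
`+ (‖D_{x-}^α f‖_{∞,[a,x]} (x-a)^α + ‖D_{*x}^α f‖_{∞,[x,b]} (b-x)^α) / (4m (n^{1-β}-2)^{2m})`. -/
def fracTerm (a b α β : ℝ) (m : ℕ) (f : ℝ → X) (n : ℕ) (x : ℝ) : ℝ :=
  (modCont (caputoRight a b α f x) (1 / (n : ℝ) ^ β) a x
      + modCont (caputoLeft a b α f x) (1 / (n : ℝ) ^ β) x b) / (n : ℝ) ^ (α * β)
    + 1 / (4 * (m : ℝ) * ((n : ℝ) ^ (1 - β) - 2) ^ (2 * m))
      * (supNormOn (caputoRight a b α f x) a x * (x - a) ^ α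
        + supNormOn (caputoLeft a b α f x) x b * (b - x) ^ α)

/-- The pointwise error bound, without subtracted Taylor corrections. -/
def pointBound (a b α β : ℝ) (m : ℕ) (f : ℝ → X) (n : ℕ) (x : ℝ) : ℝ :=
  2 * (1 + 4 ^ m : ℝ) ^ (1 / (2 * (m : ℝ))) *
    ((∑ j ∈ Finset.Icc 1 (⌈α⌉₊ - 1), ‖iteratedDerivWithin j f (Set.Icc a b) x‖ / (j ! : ℝ)
        * (1 / (n : ℝ) ^ (β * (j : ℝ))
          + (b - a) ^ j / (4 * (m : ℝ) * ((n : ℝ) ^ (1 - β) - 2) ^ (2 * m))))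
      + 1 / Real.Gamma (α + 1) * fracTerm a b α β m f n x)

/-- The uniform error bound. -/
def unifBound (a b α β : ℝ) (m : ℕ) (f : ℝ → X) (n : ℕ) : ℝ :=
  2 * (1 + 4 ^ m : ℝ) ^ (1 / (2 * (m : ℝ))) *
    ((∑ j ∈ Finset.Icc 1 (⌈α⌉₊ - 1),
        supNormOn (iteratedDerivWithin j f (Set.Icc a b)) a b / (j ! : ℝ)
        * (1 / (n : ℝ) ^ (β * (j : ℝ))
          + (b - a) ^ j / (4 * (m : ℝ) * ((n : ℝ) ^ (1 - β) - 2) ^ (2 * m))))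
      + 1 / Real.Gamma (α + 1) *
        (((⨆ x : Set.Icc a b, modCont (caputoRight a b α f x) (1 / (n : ℝ) ^ β) a x)
            + (⨆ x : Set.Icc a b, modCont (caputoLeft a b α f x) (1 / (n : ℝ) ^ β) x b))
            / (n : ℝ) ^ (α * β)
          + (b - a) ^ α / (4 * (m : ℝ) * ((n : ℝ) ^ (1 - β) - 2) ^ (2 * m))
            * ((⨆ x : Set.Icc a b, supNormOn (caputoRight a b α f x) a x)
              + (⨆ x : Set.Icc a b, supNormOn (caputoLeft a b α f x) x b))))

end Caputo

end

/-
Composing fractional integrals adds their orders (a Beta-integral computation), so the Taylor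
remainder of order `⌈α⌉`, a fractional integral of `f^{(⌈α⌉)}`, is the fractional integral of
order `α` of the Caputo derivative of order `α`; reflecting `t ↦ -t` exchanges left and right. The
operator is a weighted average over the nodes `k / n` with nonnegative weights. Consecutive
weights telescope, so the nodes at distance at least `n ^ (-β)` from `x` carry a small mass, while
a single node within distance `1 / n` already bounds the total mass from below. Near `x` the
remainder is controlled by the modulus of continuity of the Caputo derivative, which vanishes at
its base point, and far from `x` by its sup norm.
-/

section RiemannLiouville

open Set MeasureTheory ProbabilityTheory

theorem integral_sub_rpow {r : ℝ} (hr : 0 < r) (x y : ℝ) :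
    ∫ t in x..y, (y - t) ^ (r - 1) = (y - x) ^ r / r := by
  rw [intervalIntegral.integral_comp_sub_left (fun u => u ^ (r - 1)) y, sub_self,
    integral_rpow (Or.inl (by linarith)), sub_add_cancel, Real.zero_rpow hr.ne', sub_zero]

theorem intervalIntegrable_sub_rpow {r : ℝ} (hr : 0 < r) (x y : ℝ) :
    IntervalIntegrable (fun t => (y - t) ^ (r - 1)) volume x y := by
  simpa using (intervalIntegral.intervalIntegrable_rpow' (a := y - x) (b := 0)
    (r := r - 1) (by linarith)).comp_sub_left y

theorem ofReal_beta {p q : ℝ} (hp : 0 < p) (hq : 0 < q) :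
    (beta p q : ℂ) = Complex.betaIntegral p q := by
  rw [Complex.betaIntegral_eq_Gamma_mul_div _ _ (by simpa) (by simpa), beta]
  simp only [Complex.ofReal_div, Complex.ofReal_mul, ← Complex.ofReal_add, Complex.Gamma_ofReal]

theorem integral_rpow_mul_sub_rpow {p q c : ℝ} (hp : 0 < p) (hq : 0 < q) (hc : 0 < c) :
    ∫ u in (0 : ℝ)..c, u ^ (q - 1) * (c - u) ^ (p - 1) = c ^ (q + p - 1) * beta q p := by
  apply Complex.ofReal_injective
  rw [Complex.ofReal_mul, Complex.ofReal_cpow hc.le, ofReal_beta hq hp,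
    ← intervalIntegral.integral_ofReal]
  push_cast
  rw [← Complex.betaIntegral_scaled _ _ hc]
  refine intervalIntegral.integral_congr fun u hu => ?_
  rw [uIcc_of_le hc.le] at hu
  simp only [Complex.ofReal_cpow hu.1, Complex.ofReal_cpow (sub_nonneg.2 hu.2),
    Complex.ofReal_sub, Complex.ofReal_one]

theorem integral_sub_rpow_mul_sub_rpow {p q x y : ℝ} (hp : 0 < p) (hq : 0 < q) (hxy : x < y) :
    ∫ t in x..y, (y - t) ^ (p - 1) * (t - x) ^ (q - 1) = beta q p * (y - x) ^ (p + q - 1) := by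
  have hshift := intervalIntegral.integral_comp_sub_right (a := x) (b := y)
    (fun u => u ^ (q - 1) * ((y - x) - u) ^ (p - 1)) x
  simp only [sub_sub_sub_cancel_right, sub_self] at hshift
  rw [integral_rpow_mul_sub_rpow hp hq (sub_pos.2 hxy)] at hshift
  rw [mul_comm, add_comm, ← hshift]
  exact intervalIntegral.integral_congr fun t _ => mul_comm _ _

theorem intervalIntegrable_sub_rpow_mul_sub_rpow {p q x y : ℝ} (hp : 0 < p) (hq : 0 < q)
    (hxy : x < y) :
    IntervalIntegrable (fun t => (y - t) ^ (p - 1) * (t - x) ^ (q - 1)) volume x y := by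
  by_contra hnot
  have hint := integral_sub_rpow_mul_sub_rpow hp hq hxy
  rw [intervalIntegral.integral_undef hnot] at hint
  exact (mul_pos (beta_pos hq hp) (Real.rpow_pos_of_pos (sub_pos.2 hxy) _)).ne hint

/-- The triangle `x < s < t ≤ y` of pairs `(t, s)`, over which an iterated Riemann–Liouville
integral is taken. -/
def integrationTriangle (x y : ℝ) : Set (ℝ × ℝ) :=
  {z | x < z.2 ∧ z.2 < z.1 ∧ z.1 ≤ y}

theorem measurableSet_integrationTriangle (x y : ℝ) :
    MeasurableSet (integrationTriangle x y) :=
  (measurableSet_lt measurable_const measurable_snd).inter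
    ((measurableSet_lt measurable_snd measurable_fst).inter
      (measurableSet_le measurable_fst measurable_const))

theorem indicator_integrationTriangle_left {E : Type*} [Zero E] (x y t : ℝ) (F : ℝ × ℝ → E) :
    (fun s => (integrationTriangle x y).indicator F (t, s))
      = (Ioc x y).indicator (fun t => (Ioo x t).indicator fun s => F (t, s)) t := by
  ext s
  simp only [integrationTriangle, indicator_apply, ite_apply, Pi.zero_apply, mem_ofPred_eq,
    mem_Ioc, mem_Ioo]
  grind

theorem indicator_integrationTriangle_right {E : Type*} [Zero E] (x y s : ℝ) (F : ℝ × ℝ → E) :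
    (fun t => (integrationTriangle x y).indicator F (t, s))
      = (Ioo x y).indicator (fun s => (Ioc s y).indicator fun t => F (t, s)) s := by
  ext t
  simp only [integrationTriangle, indicator_apply, ite_apply, Pi.zero_apply, mem_ofPred_eq,
    mem_Ioc, mem_Ioo]
  grind

section
variable {X : Type*} [NormedAddCommGroup X] [NormedSpace ℝ X]

theorem integral_indicator_apply {ι : Type*} (S : Set ι) (G : ι → ℝ → X) (i : ι) :
    ∫ s, S.indicator G i s = S.indicator (fun i => ∫ s, G i s) i := by
  by_cases hi : i ∈ S <;> simp [hi]

theorem integral_integral_swap_triangle {x y : ℝ} (hxy : x ≤ y) {F : ℝ × ℝ → X}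
    (hF : IntegrableOn F (integrationTriangle x y)) :
    ∫ t in x..y, ∫ s in x..t, F (t, s) = ∫ s in x..y, ∫ t in s..y, F (t, s) := by
  have hswap := integral_integral_swap
    (f := fun t s => (integrationTriangle x y).indicator F (t, s))
    (hF.integrable_indicator (measurableSet_integrationTriangle x y))
  simp only [indicator_integrationTriangle_left, indicator_integrationTriangle_right,
    integral_indicator_apply, integral_indicator measurableSet_Ioo,
    integral_indicator measurableSet_Ioc] at hswap
  rw [intervalIntegral.integral_of_le hxy, intervalIntegral.integral_of_le hxy]
  calc
    _ = ∫ t in Ioc x y, ∫ s in Ioo x t, F (t, s) :=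
      setIntegral_congr_fun measurableSet_Ioc fun t ht => by
        rw [intervalIntegral.integral_of_le ht.1.le, integral_Ioc_eq_integral_Ioo]
    _ = ∫ s in Ioo x y, ∫ t in Ioc s y, F (t, s) := hswap
    _ = _ := by
      rw [integral_Ioc_eq_integral_Ioo]
      exact setIntegral_congr_fun measurableSet_Ioo fun s hs =>
        (intervalIntegral.integral_of_le hs.2.le).symm

theorem integrableOn_triangle_sub_rpow_mul_sub_rpow {p q x y : ℝ} (hp : 0 < p) (hq : 0 < q)
    (hxy : x ≤ y) :
    IntegrableOn (fun z : ℝ × ℝ => (y - z.1) ^ (p - 1) * (z.1 - z.2) ^ (q - 1))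
      (integrationTriangle x y) := by
  have hmeas := measurableSet_integrationTriangle x y
  rw [← integrable_indicator_iff hmeas, Measure.volume_eq_prod, integrable_prod_iff'
    ((Measurable.indicator (by fun_prop) hmeas).aestronglyMeasurable)]
  have hslice : ∀ s ∈ Ioo x y, IntegrableOn
      (fun t => (y - t) ^ (p - 1) * (t - s) ^ (q - 1)) (Ioc s y) := fun s hs =>
    (intervalIntegrable_iff_integrableOn_Ioc_of_le hs.2.le).1
      (intervalIntegrable_sub_rpow_mul_sub_rpow hp hq hs.2)
  constructor
  · refine .of_forall fun s => ?_
    rw [indicator_integrationTriangle_right]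
    by_cases hs : s ∈ Ioo x y
    · simpa only [indicator_of_mem hs] using (hslice s hs).integrable_indicator measurableSet_Ioc
    · simp [hs]
  · have hnorm : ∀ s, ∫ t, ‖(integrationTriangle x y).indicator
        (fun z => (y - z.1) ^ (p - 1) * (z.1 - z.2) ^ (q - 1)) (t, s)‖
          = (Ioo x y).indicator (fun s => beta q p * (y - s) ^ (p + q - 1)) s := by
      intro s
      have hpos : ∀ t, ‖(integrationTriangle x y).indicator
          (fun z => (y - z.1) ^ (p - 1) * (z.1 - z.2) ^ (q - 1)) (t, s)‖
            = (integrationTriangle x y).indicator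
              (fun z => (y - z.1) ^ (p - 1) * (z.1 - z.2) ^ (q - 1)) (t, s) := fun t =>
        Real.norm_of_nonneg <| indicator_nonneg (fun z hz => mul_nonneg
          (Real.rpow_nonneg (sub_nonneg.2 hz.2.2) _) (Real.rpow_nonneg (sub_pos.2 hz.2.1).le _)) _
      simp only [hpos, indicator_integrationTriangle_right, integral_indicator_apply,
        integral_indicator measurableSet_Ioc]
      refine congrFun (indicator_congr fun s hs => ?_) s
      rw [← intervalIntegral.integral_of_le hs.2.le, integral_sub_rpow_mul_sub_rpow hp hq hs.2]
    simp only [hnorm]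
    rw [integrable_indicator_iff measurableSet_Ioo]
    exact (((intervalIntegrable_iff_integrableOn_Ioc_of_le hxy).1
      (intervalIntegrable_sub_rpow (add_pos hp hq) x y)).mono_set Ioo_subset_Ioc_self).const_mul _

/-- The Riemann–Liouville fractional integral of order `r` with base point `x`, evaluated at `y`;
it is meaningful for `x ≤ y`. The Caputo derivative of order `α` is the one of order `⌈α⌉ - α` of
the `⌈α⌉`-th derivative. -/
noncomputable def riemannLiouville (r x : ℝ) (g : ℝ → X) (y : ℝ) : X :=
  (Real.Gamma r)⁻¹ • ∫ t in x..y, (y - t) ^ (r - 1) • g t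

theorem norm_riemannLiouville_le {r x y K : ℝ} (hr : 0 < r) (hxy : x ≤ y) {g : ℝ → X}
    (hg : ∀ t ∈ Icc x y, ‖g t‖ ≤ K) :
    ‖riemannLiouville r x g y‖ ≤ K * (y - x) ^ r / Real.Gamma (r + 1) := by
  have hΓ := Real.Gamma_pos_of_pos hr
  have hint : ‖∫ t in x..y, (y - t) ^ (r - 1) • g t‖ ≤ K * ((y - x) ^ r / r) := by
    rw [← integral_sub_rpow hr x y, ← intervalIntegral.integral_const_mul]
    refine intervalIntegral.norm_integral_le_of_norm_le hxy (.of_forall fun t ht => ?_)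
      ((intervalIntegrable_sub_rpow hr x y).const_mul K)
    have hweight : 0 ≤ (y - t) ^ (r - 1) := Real.rpow_nonneg (sub_nonneg.2 ht.2) _
    rw [norm_smul, Real.norm_of_nonneg hweight, mul_comm]
    exact mul_le_mul_of_nonneg_right (hg t (Ioc_subset_Icc_self ht)) hweight
  rw [riemannLiouville, norm_smul, norm_inv, Real.norm_of_nonneg hΓ.le, Real.Gamma_add_one hr.ne']
  calc (Real.Gamma r)⁻¹ * ‖∫ t in x..y, (y - t) ^ (r - 1) • g t‖
      ≤ (Real.Gamma r)⁻¹ * (K * ((y - x) ^ r / r)) := by gcongr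
    _ = K * (y - x) ^ r / (r * Real.Gamma r) := by field_simp

theorem riemannLiouville_congr {r x y : ℝ} (hxy : x ≤ y) {g h : ℝ → X} (hgh : EqOn g h (Icc x y)) :
    riemannLiouville r x g y = riemannLiouville r x h y := by
  rw [riemannLiouville, riemannLiouville]
  congr 1
  refine intervalIntegral.integral_congr fun t ht => ?_
  rw [uIcc_of_le hxy] at ht
  simp only [hgh ht]

theorem integrableOn_triangle_smul {x y : ℝ} {k : ℝ × ℝ → ℝ} {g : ℝ → X}
    (hk : IntegrableOn k (integrationTriangle x y)) (hg : ContinuousOn g (Icc x y)) :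
    IntegrableOn (fun z => k z • g z.2) (integrationTriangle x y) := by
  have hmem : MapsTo Prod.snd (integrationTriangle x y) (Icc x y) := fun z hz =>
    ⟨hz.1.le, (hz.2.1.trans_le hz.2.2).le⟩
  have hmeas := measurableSet_integrationTriangle x y
  obtain ⟨C, hC⟩ := isCompact_Icc.exists_bound_of_continuousOn hg
  exact hk.smul_bdd C
    ((hg.comp continuous_snd.continuousOn hmem).aestronglyMeasurable hmeas)
    ((ae_restrict_mem hmeas).mono fun z hz => hC _ (hmem hz))

theorem riemannLiouville_riemannLiouville [CompleteSpace X] {p q x y : ℝ} (hp : 0 < p)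
    (hq : 0 < q) (hxy : x ≤ y) {g : ℝ → X} (hg : ContinuousOn g (Icc x y)) :
    riemannLiouville p x (riemannLiouville q x g) y = riemannLiouville (p + q) x g y := by
  have hΓp := (Real.Gamma_pos_of_pos hp).ne'
  have hΓq := (Real.Gamma_pos_of_pos hq).ne'
  have hswap := integral_integral_swap_triangle hxy (integrableOn_triangle_smul
    (integrableOn_triangle_sub_rpow_mul_sub_rpow hp hq hxy) hg)
  have hinner : ∫ s in x..y, ∫ t in s..y, ((y - t) ^ (p - 1) * (t - s) ^ (q - 1)) • g s
      = beta q p • ∫ s in x..y, (y - s) ^ (p + q - 1) • g s := by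
    rw [← intervalIntegral.integral_smul]
    refine intervalIntegral.integral_congr_uIoo fun s hs => ?_
    rw [uIoo_of_le hxy] at hs
    rw [intervalIntegral.integral_smul_const, integral_sub_rpow_mul_sub_rpow hp hq hs.2, mul_smul]
  have houter : ∀ t, (y - t) ^ (p - 1) • riemannLiouville q x g t
      = (Real.Gamma q)⁻¹ • ∫ s in x..t, ((y - t) ^ (p - 1) * (t - s) ^ (q - 1)) • g s := by
    intro t
    simp only [riemannLiouville, mul_smul, intervalIntegral.integral_smul]
    rw [smul_comm]
  rw [riemannLiouville]
  simp only [houter]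
  rw [intervalIntegral.integral_smul, hswap, hinner, riemannLiouville, beta, smul_smul, smul_smul]
  congr 1
  rw [add_comm q]
  field_simp

end

end RiemannLiouville

section Caputo

open Set
open scoped Pointwise

variable {X : Type*} [NormedAddCommGroup X] [NormedSpace ℝ X]

theorem taylorWithinEval_eq_of_subset {s t : Set ℝ} {n : ℕ} {f : ℝ → X} {x : ℝ} (hst : s ⊆ t)
    (hs : UniqueDiffOn ℝ s) (ht : UniqueDiffOn ℝ t) (hf : ContDiffOn ℝ n f t) (hx : x ∈ s) (y : ℝ) :
    taylorWithinEval f n s x y = taylorWithinEval f n t x y := by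
  rw [taylor_within_apply, taylor_within_apply]
  refine Finset.sum_congr rfl fun k hk => ?_
  have hkn : (k : WithTop ℕ∞) ≤ n := by exact_mod_cast Finset.mem_range_succ_iff.1 hk
  rw [iteratedDerivWithin, iteratedDerivWithin,
    iteratedFDerivWithin_subset hst hs ht (hf.of_le hkn) hx]

theorem taylorWithinEval_comp_neg (f : ℝ → X) (n : ℕ) (s : Set ℝ) (x y : ℝ) :
    taylorWithinEval (fun t => f (-t)) n (-s) (-x) (-y) = taylorWithinEval f n s x y := by
  rw [taylor_within_apply, taylor_within_apply]
  refine Finset.sum_congr rfl fun k _ => ?_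
  rw [iteratedDerivWithin_comp_neg, neg_neg, neg_neg, smul_smul, mul_assoc, ← mul_pow]
  congr 3
  ring

variable {a b α : ℝ} {f : ℝ → X} {x y : ℝ}

theorem sub_taylorWithinEval_eq_riemannLiouville [CompleteSpace X] {n : ℕ}
    (hf : ContDiffOn ℝ (n + 1 : ℕ) f (Icc a b)) (hx : x ∈ Icc a b) (hy : y ∈ Icc x b) :
    f y - taylorWithinEval f n (Icc a b) x y
      = riemannLiouville (n + 1) x (iteratedDerivWithin (n + 1) f (Icc a b)) y := by
  rcases hy.1.eq_or_lt with rfl | hxy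
  · simp [riemannLiouville]
  have hsub : uIcc x y ⊆ Icc a b := uIcc_of_le hxy.le ▸ Icc_subset_Icc hx.1 hy.2
  have hab := uniqueDiffOn_Icc (hx.1.trans_lt (hxy.trans_le hy.2))
  have huniq := uniqueDiffOn_uIcc hxy.ne
  rw [← taylorWithinEval_eq_of_subset hsub huniq hab (hf.of_le (by norm_cast; omega))
      left_mem_uIcc, taylor_integral_remainder (hf.mono hsub), riemannLiouville,
    Real.Gamma_nat_eq_factorial, ← intervalIntegral.integral_smul]
  refine intervalIntegral.integral_congr fun t ht => ?_
  simp only [iteratedDerivWithin, iteratedFDerivWithin_subset hsub huniq hab hf ht]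
  rw [add_sub_cancel_right, Real.rpow_natCast, smul_smul, div_eq_inv_mul]

theorem caputoLeft_of_le (hxy : x ≤ y) :
    caputoLeft a b α f x y
      = riemannLiouville (⌈α⌉₊ - α) x (iteratedDerivWithin ⌈α⌉₊ f (Icc a b)) y := by
  rw [caputoLeft, if_pos hxy, one_div, riemannLiouville]

theorem caputoLeft_comp_neg :
    caputoLeft (-b) (-a) α (fun t => f (-t)) (-x) (-y) = caputoRight a b α f x y := by
  simp only [caputoLeft, caputoRight, neg_le_neg_iff]
  split_ifs
  · rw [← intervalIntegral.integral_comp_neg (fun t : ℝ => (-y - t) ^ ((⌈α⌉₊ : ℝ) - α - 1) •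
        iteratedDerivWithin ⌈α⌉₊ (fun t => f (-t)) (Icc (-b) (-a)) t), one_div, div_eq_inv_mul,
      mul_smul, ← intervalIntegral.integral_smul ((-1 : ℝ) ^ ⌈α⌉₊)]
    congr 1
    refine intervalIntegral.integral_congr fun t _ => ?_
    simp only [iteratedDerivWithin_comp_neg, ← neg_Icc, neg_neg]
    rw [smul_comm, neg_sub_neg]
  · rfl

theorem contDiffOn_comp_neg_Icc {k : WithTop ℕ∞} (hf : ContDiffOn ℝ k f (Icc a b)) :
    ContDiffOn ℝ k (fun t => f (-t)) (Icc (-b) (-a)) :=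
  hf.comp contDiff_neg.contDiffOn fun _ ht => ⟨le_neg_of_le_neg ht.2, neg_le_of_neg_le ht.1⟩

theorem caputoLeft_self : caputoLeft a b α f x x = 0 := by
  simp [caputoLeft]

theorem caputoRight_self : caputoRight a b α f x x = 0 := by
  simp [caputoRight]

theorem exists_forall_norm_caputoLeft_le (hab : a < b) (hα : α < ⌈α⌉₊)
    (hf : ContDiffOn ℝ (⌈α⌉₊ : ℕ) f (Icc a b)) :
    ∃ C : ℝ, ∀ x ∈ Icc a b, ∀ y ∈ Icc x b, ‖caputoLeft a b α f x y‖ ≤ C := by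
  obtain ⟨M, hM⟩ := isCompact_Icc.exists_bound_of_continuousOn
    (hf.continuousOn_iteratedDerivWithin le_rfl (uniqueDiffOn_Icc hab))
  have hM0 : 0 ≤ M := (norm_nonneg _).trans (hM a ⟨le_rfl, hab.le⟩)
  have hν : 0 < ⌈α⌉₊ - α := sub_pos.2 hα
  refine ⟨M * (b - a) ^ (⌈α⌉₊ - α) / Real.Gamma (⌈α⌉₊ - α + 1), fun x hx y hy => ?_⟩
  rw [caputoLeft_of_le hy.1]
  refine (norm_riemannLiouville_le hν hy.1 fun t ht =>
    hM t ⟨hx.1.trans ht.1, ht.2.trans hy.2⟩).trans ?_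
  have hpow : (y - x) ^ (⌈α⌉₊ - α) ≤ (b - a) ^ (⌈α⌉₊ - α) :=
    Real.rpow_le_rpow (sub_nonneg.2 hy.1) (sub_le_sub hy.2 hx.1) hν.le
  gcongr

theorem exists_forall_norm_caputo_le (hab : a < b) (hα : α < ⌈α⌉₊)
    (hf : ContDiffOn ℝ (⌈α⌉₊ : ℕ) f (Icc a b)) :
    ∃ C : ℝ, ∀ x ∈ Icc a b,
      (∀ y ∈ Icc a x, ‖caputoRight a b α f x y‖ ≤ C) ∧
      (∀ y ∈ Icc x b, ‖caputoLeft a b α f x y‖ ≤ C) := by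
  obtain ⟨L, hL⟩ := exists_forall_norm_caputoLeft_le hab hα hf
  obtain ⟨R, hR⟩ := exists_forall_norm_caputoLeft_le (neg_lt_neg hab) hα
    (contDiffOn_comp_neg_Icc hf)
  refine ⟨max R L, fun x hx => ⟨fun y hy => le_max_of_le_left ?_,
    fun y hy => le_max_of_le_right (hL x hx y hy)⟩⟩
  rw [← caputoLeft_comp_neg]
  exact hR _ ⟨neg_le_neg hx.2, neg_le_neg hx.1⟩ _ ⟨neg_le_neg hy.2, neg_le_neg hy.1⟩

theorem sub_taylorWithinEval_eq_riemannLiouville_caputoLeft [CompleteSpace X] (hα : 0 < α)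
    (hαN : α < ⌈α⌉₊) (hf : ContDiffOn ℝ (⌈α⌉₊ : ℕ) f (Icc a b)) (hx : x ∈ Icc a b)
    (hy : y ∈ Icc x b) :
    f y - taylorWithinEval f (⌈α⌉₊ - 1) (Icc a b) x y
      = riemannLiouville α x (caputoLeft a b α f x) y := by
  rcases hy.1.eq_or_lt with rfl | hxy
  · simp [riemannLiouville]
  have hN : ⌈α⌉₊ - 1 + 1 = ⌈α⌉₊ := Nat.sub_add_cancel (Nat.ceil_pos.2 hα)
  have hcont := (hf.continuousOn_iteratedDerivWithin le_rfl (uniqueDiffOn_Icc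
    (hx.1.trans_lt (hxy.trans_le hy.2)))).mono (Icc_subset_Icc hx.1 hy.2)
  have hcaputo : EqOn (caputoLeft a b α f x)
      (riemannLiouville (⌈α⌉₊ - α) x (iteratedDerivWithin ⌈α⌉₊ f (Icc a b))) (Icc x y) :=
    fun t ht => caputoLeft_of_le ht.1
  rw [riemannLiouville_congr hy.1 hcaputo,
    riemannLiouville_riemannLiouville hα (sub_pos.2 hαN) hy.1 hcont, add_sub_cancel,
    sub_taylorWithinEval_eq_riemannLiouville (by rwa [hN]) hx hy, hN]
  norm_cast
  rw [hN]

theorem norm_sub_taylorWithinEval_le_of_caputoLeft [CompleteSpace X] (hα : 0 < α)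
    (hαN : α < ⌈α⌉₊) (hf : ContDiffOn ℝ (⌈α⌉₊ : ℕ) f (Icc a b)) (hx : x ∈ Icc a b)
    (hy : y ∈ Icc x b) {K : ℝ} (hK : ∀ t ∈ Icc x y, ‖caputoLeft a b α f x t‖ ≤ K) :
    ‖f y - taylorWithinEval f (⌈α⌉₊ - 1) (Icc a b) x y‖
      ≤ K * (y - x) ^ α / Real.Gamma (α + 1) := by
  rw [sub_taylorWithinEval_eq_riemannLiouville_caputoLeft hα hαN hf hx hy]
  exact norm_riemannLiouville_le hα hy.1 hK

theorem norm_sub_taylorWithinEval_le_of_caputoRight [CompleteSpace X] (hα : 0 < α)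
    (hαN : α < ⌈α⌉₊) (hf : ContDiffOn ℝ (⌈α⌉₊ : ℕ) f (Icc a b)) (hx : x ∈ Icc a b)
    (hy : y ∈ Icc a x) {K : ℝ} (hK : ∀ t ∈ Icc y x, ‖caputoRight a b α f x t‖ ≤ K) :
    ‖f y - taylorWithinEval f (⌈α⌉₊ - 1) (Icc a b) x y‖
      ≤ K * (x - y) ^ α / Real.Gamma (α + 1) := by
  have hreflect := norm_sub_taylorWithinEval_le_of_caputoLeft hα hαN (contDiffOn_comp_neg_Icc hf)
    (x := -x) (y := -y) ⟨neg_le_neg hx.2, neg_le_neg hx.1⟩ ⟨neg_le_neg hy.2, neg_le_neg hy.1⟩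
    (K := K) fun t ht => by
      rw [← neg_neg t, caputoLeft_comp_neg]
      exact hK _ ⟨le_neg_of_le_neg ht.2, neg_le_of_neg_le ht.1⟩
  rwa [← neg_Icc, taylorWithinEval_comp_neg, neg_neg, neg_sub_neg] at hreflect

end Caputo

section Sigmoid

variable {m : ℕ}

theorem algSigmoid_zero (m : ℕ) : algSigmoid m 0 = 0 :=
  zero_div _

theorem algSigmoid_neg (m : ℕ) (x : ℝ) : algSigmoid m (-x) = -algSigmoid m x := by
  rw [algSigmoid, algSigmoid, (even_two_mul m).neg_pow, neg_div]

theorem algSigmoid_of_pos (hm : 1 ≤ m) {x : ℝ} (hx : 0 < x) :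
    algSigmoid m x = ((1 + (x ^ (2 * m))⁻¹) ^ (1 / (2 * (m : ℝ))))⁻¹ := by
  have hroot : (x ^ (2 * m)) ^ (1 / (2 * (m : ℝ))) = x := by
    have hexp : 1 / (2 * (m : ℝ)) = ((2 * m : ℕ) : ℝ)⁻¹ := by simp
    rw [hexp, Real.pow_rpow_inv_natCast hx.le (by omega)]
  have hfactor : 1 + x ^ (2 * m) = x ^ (2 * m) * (1 + (x ^ (2 * m))⁻¹) := by
    field_simp
    ring
  rw [algSigmoid, hfactor, Real.mul_rpow (by positivity) (by positivity), hroot]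
  field_simp

theorem algSigmoid_nonneg {x : ℝ} (hx : 0 ≤ x) : 0 ≤ algSigmoid m x := by
  rw [algSigmoid]
  positivity

theorem algSigmoid_monotone (hm : 1 ≤ m) : Monotone (algSigmoid m) := by
  refine monotone_of_odd_of_monotoneOn_nonneg (algSigmoid_neg m) fun x hx y hy hxy => ?_
  rcases (Set.mem_Ici.1 hx).eq_or_lt with rfl | hx0
  · exact (algSigmoid_zero m).trans_le (algSigmoid_nonneg hy)
  have hy0 := hx0.trans_le hxy
  rw [algSigmoid_of_pos hm hx0, algSigmoid_of_pos hm hy0]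
  gcongr

theorem algSigmoid_le_one (hm : 1 ≤ m) (x : ℝ) : algSigmoid m x ≤ 1 := by
  have hx : 0 < max x 1 := lt_max_of_lt_right one_pos
  refine (algSigmoid_monotone hm (le_max_left x 1)).trans ?_
  rw [algSigmoid_of_pos hm hx]
  exact inv_le_one_of_one_le₀ (Real.one_le_rpow (le_add_of_nonneg_right (by positivity))
    (by positivity))

theorem one_sub_algSigmoid_le (hm : 1 ≤ m) {x : ℝ} (hx : 0 < x) :
    1 - algSigmoid m x ≤ 1 / (2 * m * x ^ (2 * m)) := by
  have hm1 : (1 : ℝ) ≤ m := by exact_mod_cast hm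
  set v := (x ^ (2 * m))⁻¹ with hv
  have hv0 : 0 < v := by positivity
  set r := (1 + v) ^ (1 / (2 * (m : ℝ))) with hr
  have hr0 : 0 < r := by positivity
  have hbernoulli : r ≤ 1 + 1 / (2 * m) * v :=
    rpow_one_add_le_one_add_mul_self (by linarith) (by positivity)
      ((div_le_one (by positivity)).2 (by linarith))
  rw [algSigmoid_of_pos hm hx, ← hv, ← hr]
  calc 1 - r⁻¹ ≤ r - 1 :=
        (Real.one_sub_inv_le_log_of_pos hr0).trans (Real.log_le_sub_one_of_pos hr0)
    _ ≤ 1 / (2 * m) * v := by linarith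
    _ = 1 / (2 * m * x ^ (2 * m)) := by rw [hv, ← one_div, one_div_mul_one_div]

theorem mul_algSigmoid_le {y z : ℝ} (hy : 0 ≤ y) (hyz : y ≤ z) :
    y * algSigmoid m z ≤ z * algSigmoid m y := by
  have hz := hy.trans hyz
  rw [algSigmoid, algSigmoid, mul_div_left_comm]
  gcongr

theorem algDensity_nonneg (hm : 1 ≤ m) (x : ℝ) : 0 ≤ algDensity m x := by
  have := algSigmoid_monotone hm (show x - 1 ≤ x + 1 by linarith)
  rw [algDensity]
  linarith

theorem algDensity_one (m : ℕ) :
    algDensity m 1 = (2 * (1 + 4 ^ m : ℝ) ^ (1 / (2 * (m : ℝ))))⁻¹ := by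
  rw [algDensity, sub_self, algSigmoid_zero, sub_zero, algSigmoid, one_add_one_eq_two, pow_mul,
    mul_inv]
  norm_num
  ring

theorem algDensity_one_pos (m : ℕ) : 0 < algDensity m 1 := by
  rw [algDensity_one]
  positivity

theorem algDensity_one_le_one (hm : 1 ≤ m) : algDensity m 1 ≤ 1 := by
  rw [algDensity, sub_self, algSigmoid_zero, sub_zero]
  exact (mul_le_of_le_one_right (by norm_num) (algSigmoid_le_one hm _)).trans (by norm_num)

theorem algDensity_one_le {x : ℝ} (hx : |x| ≤ 1) : algDensity m 1 ≤ algDensity m x := by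
  obtain ⟨hx1, hx2⟩ := abs_le.1 hx
  have hright := mul_algSigmoid_le (m := m) (y := 1 + x) (z := 2) (by linarith) (by linarith)
  have hleft := mul_algSigmoid_le (m := m) (y := 1 - x) (z := 2) (by linarith) (by linarith)
  rw [algDensity, algDensity, ← neg_sub 1 x, algSigmoid_neg, sub_self, algSigmoid_zero,
    add_comm x 1, one_add_one_eq_two]
  linarith

theorem sum_add_one_sub_le {F : ℤ → ℝ} (hF : Monotone F) (S : Finset ℤ) {c C : ℝ}
    (hc : ∀ k ∈ S, c ≤ F k) (hC : ∀ k ∈ S, F (k + 1) ≤ C) (hcC : c ≤ C) :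
    ∑ k ∈ S, (F (k + 1) - F k) ≤ C - c := by
  induction S using Finset.induction_on_max generalizing C with
  | empty => simpa using hcC
  | insert l S hl ih =>
    rw [Finset.sum_insert fun hmem => (hl l hmem).false]
    have hinit : ∑ k ∈ S, (F (k + 1) - F k) ≤ F l - c :=
      ih (fun k hk => hc k (Finset.mem_insert_of_mem hk))
        (fun k hk => hF (hl k hk)) (hc l (Finset.mem_insert_self l S))
    linarith [hC l (Finset.mem_insert_self l S)]

theorem sum_algDensity_le (hm : 1 ≤ m) (x : ℝ) (S : Finset ℤ) {U V : ℝ} (hVU : V ≤ U)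
    (hU : ∀ k ∈ S, algSigmoid m (x - k + 1) ≤ U) (hV : ∀ k ∈ S, V ≤ algSigmoid m (x - k - 1)) :
    ∑ k ∈ S, algDensity m (x - k) ≤ (U - V) / 2 := by
  have hmono := algSigmoid_monotone hm
  let F : ℤ → ℝ := fun k => -(1 / 4) * (algSigmoid m (x - k) + algSigmoid m (x - k + 1))
  have hstep : ∀ k : ℤ, algDensity m (x - k) = F (k + 1) - F k := by
    intro k
    simp only [F, algDensity, Int.cast_add, Int.cast_one]
    rw [← sub_sub, sub_add_cancel]
    ring
  have hF : Monotone F := monotone_int_of_le_succ fun k => by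
    rw [← sub_nonneg, ← hstep]
    exact algDensity_nonneg hm _
  simp only [hstep]
  refine (sum_add_one_sub_le hF S (c := -(1 / 2) * U) (C := -(1 / 2) * V) (fun k hk => ?_)
    (fun k hk => ?_) (by linarith)).trans_eq (by ring)
  · have := hmono (show x - k ≤ x - k + 1 by linarith)
    simp only [F]
    linarith [hU k hk]
  · have := hmono (show x - k - 1 ≤ x - k by linarith)
    simp only [F, Int.cast_add, Int.cast_one, ← sub_sub, sub_add_cancel]
    linarith [hV k hk]

theorem half_one_sub_algSigmoid_le (hm : 1 ≤ m) {T : ℝ} (hT : 1 < T) :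
    (1 - algSigmoid m (T - 1)) / 2 ≤ 1 / (4 * m * (T - 1) ^ (2 * m)) := by
  calc (1 - algSigmoid m (T - 1)) / 2 ≤ 1 / (2 * m * (T - 1) ^ (2 * m)) / 2 := by
        gcongr
        exact one_sub_algSigmoid_le hm (sub_pos.2 hT)
    _ = 1 / (4 * m * (T - 1) ^ (2 * m)) := by
        rw [div_div]
        ring

theorem sum_algDensity_left_le (hm : 1 ≤ m) {T : ℝ} (hT : 1 < T) (x : ℝ) (S : Finset ℤ)
    (hS : ∀ k ∈ S, T ≤ x - k) :
    ∑ k ∈ S, algDensity m (x - k) ≤ 1 / (4 * m * (T - 1) ^ (2 * m)) :=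
  (sum_algDensity_le hm x S (algSigmoid_le_one hm _) (fun _ _ => algSigmoid_le_one hm _)
    fun k hk => algSigmoid_monotone hm (sub_le_sub_right (hS k hk) 1)).trans
    (half_one_sub_algSigmoid_le hm hT)

theorem sum_algDensity_right_le (hm : 1 ≤ m) {T : ℝ} (hT : 1 < T) (x : ℝ) (S : Finset ℤ)
    (hS : ∀ k ∈ S, T ≤ k - x) :
    ∑ k ∈ S, algDensity m (x - k) ≤ 1 / (4 * m * (T - 1) ^ (2 * m)) := by
  have hle : ∀ y, -1 ≤ algSigmoid m y := fun y => by
    rw [neg_le, ← algSigmoid_neg]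
    exact algSigmoid_le_one hm _
  refine (sum_algDensity_le hm x S (U := -algSigmoid m (T - 1)) (V := -1)
    (neg_le_neg (algSigmoid_le_one hm _)) (fun k hk => ?_) fun _ _ => hle _).trans
    (le_trans (by linarith) (half_one_sub_algSigmoid_le hm hT))
  rw [← algSigmoid_neg]
  exact algSigmoid_monotone hm (by linarith [hS k hk])

theorem exists_mem_Icc_ceil_floor_abs_sub_le_one {c d x : ℝ} (hcd : ⌈c⌉ ≤ ⌊d⌋)
    (hx : x ∈ Set.Icc c d) : ∃ k ∈ Finset.Icc ⌈c⌉ ⌊d⌋, |x - (k : ℝ)| ≤ 1 := by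
  rcases le_total ⌈c⌉ ⌊x⌋ with hfloor | hceil
  · refine ⟨⌊x⌋, Finset.mem_Icc.2 ⟨hfloor, Int.floor_le_floor hx.2⟩, abs_le.2 ⟨?_, ?_⟩⟩ <;>
      linarith [Int.floor_le x, Int.lt_floor_add_one x]
  · have hceil' : (⌊x⌋ : ℝ) ≤ ⌈c⌉ := by exact_mod_cast hceil
    refine ⟨⌈c⌉, Finset.left_mem_Icc.2 hcd, abs_le.2 ⟨?_, ?_⟩⟩ <;>
      linarith [Int.ceil_lt_add_one c, Int.lt_floor_add_one x, hx.1]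

theorem algDensity_one_le_sum (hm : 1 ≤ m) {c d x : ℝ} (hcd : ⌈c⌉ ≤ ⌊d⌋)
    (hx : x ∈ Set.Icc c d) :
    algDensity m 1 ≤ ∑ k ∈ Finset.Icc ⌈c⌉ ⌊d⌋, algDensity m (x - k) := by
  obtain ⟨k, hk, hkx⟩ := exists_mem_Icc_ceil_floor_abs_sub_le_one hcd hx
  exact (algDensity_one_le hkx).trans (Finset.single_le_sum
    (f := fun k : ℤ => algDensity m (x - k)) (fun _ _ => algDensity_nonneg hm _) hk)

end Sigmoid

section Operator

open Set

theorem div_mem_Icc_of_mem_ceil_floor {a b : ℝ} {n : ℕ} (hn : 0 < (n : ℝ)) {k : ℤ}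
    (hk : k ∈ Finset.Icc ⌈(n : ℝ) * a⌉ ⌊(n : ℝ) * b⌋) : (k : ℝ) / n ∈ Icc a b := by
  rw [Finset.mem_Icc, Int.ceil_le, Int.le_floor] at hk
  rw [mem_Icc, le_div_iff₀ hn, div_le_iff₀ hn, mul_comm a, mul_comm b]
  exact hk

variable {V : Type*} {m n : ℕ} {a b x δ : ℝ}

section Linear

variable [AddCommGroup V] [Module ℝ V]

theorem neuralOp_add (g h : ℝ → V) :
    neuralOp m a b n (fun y => g y + h y) x = neuralOp m a b n g x + neuralOp m a b n h x := by
  simp only [neuralOp, smul_add, Finset.sum_add_distrib]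

theorem neuralOp_sub (g h : ℝ → V) :
    neuralOp m a b n (fun y => g y - h y) x = neuralOp m a b n g x - neuralOp m a b n h x := by
  simp only [neuralOp, smul_sub, Finset.sum_sub_distrib]

theorem neuralOp_sum {ι : Type*} (s : Finset ι) (g : ι → ℝ → V) :
    neuralOp m a b n (fun y => ∑ i ∈ s, g i y) x = ∑ i ∈ s, neuralOp m a b n (g i) x := by
  simp only [neuralOp, Finset.smul_sum]
  exact Finset.sum_comm

theorem neuralOp_smul_const (g : ℝ → ℝ) (v : V) :
    neuralOp m a b n (fun y => g y • v) x = neuralOp m a b n g x • v := by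
  simp only [neuralOp, smul_eq_mul, mul_smul, Finset.sum_smul]

theorem algDensity_one_le_sum_natCast_mul (hm : 1 ≤ m) (hab : ⌈(n : ℝ) * a⌉ ≤ ⌊(n : ℝ) * b⌋)
    (hx : x ∈ Icc a b) :
    algDensity m 1 ≤ ∑ k ∈ Finset.Icc ⌈(n : ℝ) * a⌉ ⌊(n : ℝ) * b⌋, algDensity m (n * x - k) :=
  algDensity_one_le_sum hm hab
    ⟨mul_le_mul_of_nonneg_left hx.1 n.cast_nonneg, mul_le_mul_of_nonneg_left hx.2 n.cast_nonneg⟩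

theorem neuralOp_const (hm : 1 ≤ m) (hab : ⌈(n : ℝ) * a⌉ ≤ ⌊(n : ℝ) * b⌋) (hx : x ∈ Icc a b)
    (v : V) : neuralOp m a b n (fun _ => v) x = v :=
  Finset.centerMass_const
    ((algDensity_one_pos m).trans_le (algDensity_one_le_sum_natCast_mul hm hab hx)).ne' v

end Linear

theorem neuralOp_indicator_le (hm : 1 ≤ m) (hab : ⌈(n : ℝ) * a⌉ ≤ ⌊(n : ℝ) * b⌋)
    (hx : x ∈ Icc a b) {S : Set ℝ} {B τ : ℝ} (hB : 0 ≤ B)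
    (hS : ∀ I : Finset ℤ, (∀ k ∈ I, (k : ℝ) / n ∈ S) → ∑ k ∈ I, algDensity m (n * x - k) ≤ τ) :
    neuralOp m a b n (S.indicator fun _ => B) x ≤ (algDensity m 1)⁻¹ * (τ * B) := by
  classical
  set I := Finset.Icc ⌈(n : ℝ) * a⌉ ⌊(n : ℝ) * b⌋
  have hsum : ∑ k ∈ I, algDensity m (n * x - k) • S.indicator (fun _ => B) ((k : ℝ) / n)
      = (∑ k ∈ I with ((k : ℤ) : ℝ) / n ∈ S, algDensity m (n * x - k)) * B := by
    simp only [indicator_apply, smul_eq_mul, mul_ite, mul_zero, Finset.sum_filter, Finset.sum_mul,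
      ite_mul, zero_mul]
  rw [neuralOp, hsum, smul_eq_mul]
  refine mul_le_mul
    (inv_anti₀ (algDensity_one_pos m) (algDensity_one_le_sum_natCast_mul hm hab hx))
    (mul_le_mul_of_nonneg_right (hS _ fun k hk => (Finset.mem_filter.1 hk).2) hB)
    (mul_nonneg (Finset.sum_nonneg fun _ _ => algDensity_nonneg hm _) hB)
    (inv_nonneg.2 (algDensity_one_pos m).le)

theorem neuralOp_indicator_Iic_le (hm : 1 ≤ m) (hn : 0 < (n : ℝ)) (hδ : 1 < n * δ)
    (hab : ⌈(n : ℝ) * a⌉ ≤ ⌊(n : ℝ) * b⌋) (hx : x ∈ Icc a b) {B : ℝ} (hB : 0 ≤ B) :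
    neuralOp m a b n ((Iic (x - δ)).indicator fun _ => B) x
      ≤ (algDensity m 1)⁻¹ * (1 / (4 * m * (n * δ - 1) ^ (2 * m)) * B) :=
  neuralOp_indicator_le hm hab hx hB fun I hI => sum_algDensity_left_le hm hδ _ I fun k hk => by
    have hk' := (div_le_iff₀ hn).1 (hI k hk)
    linarith

theorem neuralOp_indicator_Ici_le (hm : 1 ≤ m) (hn : 0 < (n : ℝ)) (hδ : 1 < n * δ)
    (hab : ⌈(n : ℝ) * a⌉ ≤ ⌊(n : ℝ) * b⌋) (hx : x ∈ Icc a b) {C : ℝ} (hC : 0 ≤ C) :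
    neuralOp m a b n ((Ici (x + δ)).indicator fun _ => C) x
      ≤ (algDensity m 1)⁻¹ * (1 / (4 * m * (n * δ - 1) ^ (2 * m)) * C) :=
  neuralOp_indicator_le hm hab hx hC fun I hI => sum_algDensity_right_le hm hδ _ I fun k hk => by
    have hk' := (le_div_iff₀ hn).1 (hI k hk)
    linarith

theorem norm_le_const_add_indicator_add_indicator [SeminormedAddGroup V]
    (hx : x ∈ Icc a b) (hδ : 0 ≤ δ) {h : ℝ → V} {A B C : ℝ}
    (hnear : ∀ y ∈ Icc a b, |y - x| ≤ δ → ‖h y‖ ≤ A) (hleft : ∀ y ∈ Icc a x, ‖h y‖ ≤ B)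
    (hright : ∀ y ∈ Icc x b, ‖h y‖ ≤ C) {y : ℝ} (hy : y ∈ Icc a b) :
    ‖h y‖ ≤ A + (Iic (x - δ)).indicator (fun _ => B) y
      + (Ici (x + δ)).indicator (fun _ => C) y := by
  have hA : 0 ≤ A := (norm_nonneg _).trans (hnear x hx (by simpa using hδ))
  have hB : 0 ≤ B := (norm_nonneg _).trans (hleft x ⟨hx.1, le_rfl⟩)
  have hC : 0 ≤ C := (norm_nonneg _).trans (hright x ⟨le_rfl, hx.2⟩)
  have hindB : 0 ≤ (Iic (x - δ)).indicator (fun _ => B) y := indicator_nonneg (fun _ _ => hB) y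
  have hindC : 0 ≤ (Ici (x + δ)).indicator (fun _ => C) y := indicator_nonneg (fun _ _ => hC) y
  by_cases hyl : y ∈ Iic (x - δ)
  · rw [indicator_of_mem hyl]
    linarith [hleft y ⟨hy.1, hyl.trans (sub_le_self x hδ)⟩]
  by_cases hyr : y ∈ Ici (x + δ)
  · rw [indicator_of_mem hyr]
    linarith [hright y ⟨(le_add_of_nonneg_right hδ).trans hyr, hy.2⟩]
  rw [mem_Iic, not_le] at hyl
  rw [mem_Ici, not_le] at hyr
  linarith [hnear y hy (abs_sub_le_iff.2 ⟨by linarith, by linarith⟩)]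

variable [NormedAddCommGroup V] [NormedSpace ℝ V]

theorem norm_neuralOp_le_neuralOp (hm : 1 ≤ m) (hn : 0 < (n : ℝ)) {h : ℝ → V} {r : ℝ → ℝ}
    (hr : ∀ y ∈ Icc a b, ‖h y‖ ≤ r y) : ‖neuralOp m a b n h x‖ ≤ neuralOp m a b n r x := by
  have hΦ : ∀ k : ℤ, 0 ≤ algDensity m (n * x - k) := fun k => algDensity_nonneg hm _
  have hinv := inv_nonneg.2 (Finset.sum_nonneg fun k (_ : k ∈ Finset.Icc ⌈n * a⌉ ⌊n * b⌋) => hΦ k)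
  rw [neuralOp, neuralOp, norm_smul, Real.norm_of_nonneg hinv]
  refine mul_le_mul_of_nonneg_left (norm_sum_le_of_le _ fun k hk => ?_) hinv
  rw [norm_smul, Real.norm_of_nonneg (hΦ k)]
  exact mul_le_mul_of_nonneg_left (hr _ (div_mem_Icc_of_mem_ceil_floor hn hk)) (hΦ k)

theorem norm_neuralOp_le (hm : 1 ≤ m) (hδ : 1 < n * δ) (hab : ⌈(n : ℝ) * a⌉ ≤ ⌊(n : ℝ) * b⌋)
    (hx : x ∈ Icc a b) {h : ℝ → V} {A B C : ℝ}
    (hnear : ∀ y ∈ Icc a b, |y - x| ≤ δ → ‖h y‖ ≤ A)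
    (hleft : ∀ y ∈ Icc a x, ‖h y‖ ≤ B) (hright : ∀ y ∈ Icc x b, ‖h y‖ ≤ C) :
    ‖neuralOp m a b n h x‖
      ≤ (algDensity m 1)⁻¹ * (A + (B + C) / (4 * m * (n * δ - 1) ^ (2 * m))) := by
  have hδ0 : 0 < δ := pos_of_mul_pos_right (one_pos.trans hδ) n.cast_nonneg
  have hn : 0 < (n : ℝ) := pos_of_mul_pos_left (one_pos.trans hδ) hδ0.le
  have hA : 0 ≤ A := (norm_nonneg _).trans (hnear x hx (by simpa using hδ0.le))
  have hB : 0 ≤ B := (norm_nonneg _).trans (hleft x ⟨hx.1, le_rfl⟩)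
  have hC : 0 ≤ C := (norm_nonneg _).trans (hright x ⟨le_rfl, hx.2⟩)
  set τ := 1 / (4 * m * (n * δ - 1) ^ (2 * m)) with hτ
  calc ‖neuralOp m a b n h x‖
      ≤ neuralOp m a b n (fun y => A + (Iic (x - δ)).indicator (fun _ => B) y
          + (Ici (x + δ)).indicator (fun _ => C) y) x :=
        norm_neuralOp_le_neuralOp hm hn fun _ hy =>
          norm_le_const_add_indicator_add_indicator hx hδ0.le hnear hleft hright hy
    _ = A + neuralOp m a b n ((Iic (x - δ)).indicator fun _ => B) x
          + neuralOp m a b n ((Ici (x + δ)).indicator fun _ => C) x := by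
        rw [neuralOp_add, neuralOp_add, neuralOp_const hm hab hx]
    _ ≤ (algDensity m 1)⁻¹ * A + (algDensity m 1)⁻¹ * (τ * B)
          + (algDensity m 1)⁻¹ * (τ * C) :=
        add_le_add_three
          (le_mul_of_one_le_left hA
            ((one_le_inv₀ (algDensity_one_pos m)).2 (algDensity_one_le_one hm)))
          (neuralOp_indicator_Iic_le hm hn hδ hab hx hB)
          (neuralOp_indicator_Ici_le hm hn hδ hab hx hC)
    _ = (algDensity m 1)⁻¹ * (A + (B + C) / (4 * m * (n * δ - 1) ^ (2 * m))) := by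
        rw [hτ]
        ring

theorem natCast_pos_of_two_lt_rpow {r : ℝ} (hr : 0 < r) (hn : 2 < (n : ℝ) ^ r) : 0 < (n : ℝ) := by
  refine n.cast_nonneg.lt_of_ne' fun hzero => ?_
  rw [hzero, Real.zero_rpow hr.ne'] at hn
  linarith

theorem norm_neuralOp_le_of_two_lt_rpow (hm : 1 ≤ m) {β : ℝ} (hβ : β < 1)
    (hn : 2 < (n : ℝ) ^ (1 - β)) (hab : ⌈(n : ℝ) * a⌉ ≤ ⌊(n : ℝ) * b⌋) (hx : x ∈ Icc a b)
    {h : ℝ → V} {A B C : ℝ} (hnear : ∀ y ∈ Icc a b, |y - x| ≤ 1 / (n : ℝ) ^ β → ‖h y‖ ≤ A)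
    (hleft : ∀ y ∈ Icc a x, ‖h y‖ ≤ B) (hright : ∀ y ∈ Icc x b, ‖h y‖ ≤ C) :
    ‖neuralOp m a b n h x‖ ≤ 2 * (1 + 4 ^ m : ℝ) ^ (1 / (2 * (m : ℝ))) *
      (A + (B + C) / (4 * (m : ℝ) * ((n : ℝ) ^ (1 - β) - 2) ^ (2 * m))) := by
  have hB : 0 ≤ B := (norm_nonneg _).trans (hleft x ⟨hx.1, le_rfl⟩)
  have hC : 0 ≤ C := (norm_nonneg _).trans (hright x ⟨le_rfl, hx.2⟩)
  have hδ : n * (1 / (n : ℝ) ^ β) = (n : ℝ) ^ (1 - β) := by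
    rw [Real.rpow_sub (natCast_pos_of_two_lt_rpow (sub_pos.2 hβ) hn), Real.rpow_one, mul_one_div]
  have hop := norm_neuralOp_le hm (δ := 1 / (n : ℝ) ^ β) (by linarith) hab hx hnear hleft hright
  rw [hδ, algDensity_one, inv_inv] at hop
  refine hop.trans ?_
  gcongr
  norm_num

theorem taylorWithinEval_eq_add_sum_Icc (f : ℝ → V) (N : ℕ) (s : Set ℝ) (x y : ℝ) :
    taylorWithinEval f N s x y = f x + ∑ j ∈ Finset.Icc 1 N,
      (y - x) ^ j • ((1 / (j ! : ℝ)) • iteratedDerivWithin j f s x) := by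
  rw [taylor_within_apply, Finset.range_eq_Ico, Finset.sum_eq_sum_Ico_succ_bot (by omega)]
  congr 1
  · simp
  · refine Finset.sum_congr (by ext; simp) fun j _ => ?_
    rw [smul_smul, one_div, mul_comm]

theorem neuralOp_sub_taylorWithinEval (hm : 1 ≤ m) (hab : ⌈(n : ℝ) * a⌉ ≤ ⌊(n : ℝ) * b⌋)
    (hx : x ∈ Icc a b) (f : ℝ → V) (N : ℕ) (s : Set ℝ) :
    neuralOp m a b n (fun y => f y - taylorWithinEval f N s x y) x
      = neuralOp m a b n f x
        - (∑ j ∈ Finset.Icc 1 N, neuralOp m a b n (fun t : ℝ => (t - x) ^ j) x •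
            ((1 / (j ! : ℝ)) • iteratedDerivWithin j f s x))
        - f x := by
  simp only [taylorWithinEval_eq_add_sum_Icc]
  rw [neuralOp_sub, neuralOp_add, neuralOp_const hm hab hx, neuralOp_sum, sub_sub, add_comm (f x)]
  simp only [neuralOp_smul_const]

theorem norm_neuralOp_sub_pow_le (hm : 1 ≤ m) {β : ℝ} (hβ : β < 1)
    (hn : 2 < (n : ℝ) ^ (1 - β)) (hab : ⌈(n : ℝ) * a⌉ ≤ ⌊(n : ℝ) * b⌋) (hx : x ∈ Icc a b)
    {j : ℕ} (hj : 1 ≤ j) :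
    ‖neuralOp m a b n (fun t : ℝ => (t - x) ^ j) x‖
      ≤ 2 * (1 + 4 ^ m : ℝ) ^ (1 / (2 * (m : ℝ))) * (1 / (n : ℝ) ^ (β * (j : ℝ))
          + (b - a) ^ j / (4 * (m : ℝ) * ((n : ℝ) ^ (1 - β) - 2) ^ (2 * m))) := by
  have hpow : (x - a) ^ j + (b - x) ^ j ≤ (b - a) ^ j := by
    simpa using pow_add_pow_le (sub_nonneg.2 hx.1) (sub_nonneg.2 hx.2) (n := j) (by omega)
  refine (norm_neuralOp_le_of_two_lt_rpow hm hβ hn hab hx (A := 1 / (n : ℝ) ^ (β * (j : ℝ)))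
    (B := (x - a) ^ j) (C := (b - x) ^ j) (fun y _ hyx => ?_) (fun y hy => ?_)
    (fun y hy => ?_)).trans (by gcongr)
  · rw [norm_pow, Real.norm_eq_abs, Real.rpow_mul n.cast_nonneg, Real.rpow_natCast, ← one_div_pow]
    exact pow_le_pow_left₀ (abs_nonneg _) hyx j
  · rw [norm_pow, norm_sub_rev, Real.norm_of_nonneg (sub_nonneg.2 hy.2)]
    exact pow_le_pow_left₀ (sub_nonneg.2 hy.2) (sub_le_sub_left hy.1 x) j
  · rw [norm_pow, Real.norm_of_nonneg (sub_nonneg.2 hy.1)]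
    exact pow_le_pow_left₀ (sub_nonneg.2 hy.1) (sub_le_sub_right hy.2 x) j

end Operator

section Seminorms

open Set

variable {V : Type*} [NormedAddCommGroup V] {g : ℝ → V} {c d δ C : ℝ}

theorem bddAbove_norm_image (hg : ∀ y ∈ Icc c d, ‖g y‖ ≤ C) :
    BddAbove ((fun y => ‖g y‖) '' Icc c d) :=
  ⟨C, forall_mem_image.2 hg⟩

theorem norm_le_supNormOn (hg : ∀ y ∈ Icc c d, ‖g y‖ ≤ C) {y : ℝ} (hy : y ∈ Icc c d) :
    ‖g y‖ ≤ supNormOn g c d :=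
  le_csSup (bddAbove_norm_image hg) (mem_image_of_mem _ hy)

theorem supNormOn_nonneg : 0 ≤ supNormOn g c d :=
  Real.sSup_nonneg (forall_mem_image.2 fun _ _ => norm_nonneg _)

theorem supNormOn_le (hcd : c ≤ d) (hg : ∀ y ∈ Icc c d, ‖g y‖ ≤ C) : supNormOn g c d ≤ C :=
  csSup_le ((nonempty_Icc.2 hcd).image _) (forall_mem_image.2 hg)

theorem modCont_nonneg : 0 ≤ modCont g δ c d := by
  refine Real.sSup_nonneg ?_
  rintro _ ⟨u, _, v, _, _, rfl⟩
  exact norm_nonneg _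

theorem norm_sub_le_two_mul (hg : ∀ y ∈ Icc c d, ‖g y‖ ≤ C) {u v : ℝ}
    (hu : u ∈ Icc c d) (hv : v ∈ Icc c d) : ‖g u - g v‖ ≤ 2 * C := by
  rw [two_mul]
  exact norm_sub_le_of_le (hg u hu) (hg v hv)

theorem norm_sub_le_modCont (hg : ∀ y ∈ Icc c d, ‖g y‖ ≤ C) {u v : ℝ}
    (hu : u ∈ Icc c d) (hv : v ∈ Icc c d) (huv : |u - v| ≤ δ) :
    ‖g u - g v‖ ≤ modCont g δ c d := by
  refine le_csSup ⟨2 * C, ?_⟩ ⟨u, hu, v, hv, huv, rfl⟩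
  rintro _ ⟨u, hu, v, hv, _, rfl⟩
  exact norm_sub_le_two_mul hg hu hv

theorem modCont_le (hcd : c ≤ d) (hg : ∀ y ∈ Icc c d, ‖g y‖ ≤ C) : modCont g δ c d ≤ 2 * C := by
  have hC : 0 ≤ C := (norm_nonneg _).trans (hg c (left_mem_Icc.2 hcd))
  refine Real.sSup_le ?_ (by positivity)
  rintro _ ⟨u, hu, v, hv, _, rfl⟩
  exact norm_sub_le_two_mul hg hu hv

variable {ι : Type*} {g : ι → ℝ → V} {c d : ι → ℝ}

theorem supNormOn_le_iSup (hcd : ∀ i, c i ≤ d i) (hg : ∀ i, ∀ y ∈ Icc (c i) (d i), ‖g i y‖ ≤ C)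
    (i : ι) : supNormOn (g i) (c i) (d i) ≤ ⨆ i, supNormOn (g i) (c i) (d i) :=
  le_ciSup (f := fun i => supNormOn (g i) (c i) (d i))
    ⟨C, forall_mem_range.2 fun j => supNormOn_le (hcd j) (hg j)⟩ i

theorem modCont_le_iSup (hcd : ∀ i, c i ≤ d i) (hg : ∀ i, ∀ y ∈ Icc (c i) (d i), ‖g i y‖ ≤ C)
    (i : ι) : modCont (g i) δ (c i) (d i) ≤ ⨆ i, modCont (g i) δ (c i) (d i) :=
  le_ciSup (f := fun i => modCont (g i) δ (c i) (d i))
    ⟨2 * C, forall_mem_range.2 fun j => modCont_le (hcd j) (hg j)⟩ i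

theorem iSup_modCont_le [Nonempty ι] (hcd : ∀ i, c i ≤ d i)
    (hg : ∀ i, ∀ y ∈ Icc (c i) (d i), ‖g i y‖ ≤ C) :
    ⨆ i, modCont (g i) δ (c i) (d i) ≤ 2 * C :=
  ciSup_le fun i => modCont_le (hcd i) (hg i)

end Seminorms

section CaputoTaylor

open Set

variable {X : Type*} [NormedAddCommGroup X] [NormedSpace ℝ X] {a b α : ℝ} {f : ℝ → X} {x y δ : ℝ}

theorem norm_sub_taylorWithinEval_le_supNormOn_caputoLeft [CompleteSpace X] (hab : a < b)
    (hα : 0 < α) (hαN : α < ⌈α⌉₊) (hf : ContDiffOn ℝ (⌈α⌉₊ : ℕ) f (Icc a b)) (hx : x ∈ Icc a b)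
    (hy : y ∈ Icc x b) :
    ‖f y - taylorWithinEval f (⌈α⌉₊ - 1) (Icc a b) x y‖
      ≤ supNormOn (caputoLeft a b α f x) x b * (b - x) ^ α / Real.Gamma (α + 1) := by
  obtain ⟨C, hC⟩ := exists_forall_norm_caputo_le hab hαN hf
  have hsup : 0 ≤ supNormOn (caputoLeft a b α f x) x b := supNormOn_nonneg
  have hpow : (y - x) ^ α ≤ (b - x) ^ α :=
    Real.rpow_le_rpow (sub_nonneg.2 hy.1) (sub_le_sub_right hy.2 x) hα.le
  refine (norm_sub_taylorWithinEval_le_of_caputoLeft hα hαN hf hx hy fun t ht =>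
    norm_le_supNormOn (hC x hx).2 ⟨ht.1, ht.2.trans hy.2⟩).trans ?_
  gcongr

theorem norm_sub_taylorWithinEval_le_supNormOn_caputoRight [CompleteSpace X] (hab : a < b)
    (hα : 0 < α) (hαN : α < ⌈α⌉₊) (hf : ContDiffOn ℝ (⌈α⌉₊ : ℕ) f (Icc a b)) (hx : x ∈ Icc a b)
    (hy : y ∈ Icc a x) :
    ‖f y - taylorWithinEval f (⌈α⌉₊ - 1) (Icc a b) x y‖
      ≤ supNormOn (caputoRight a b α f x) a x * (x - a) ^ α / Real.Gamma (α + 1) := by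
  obtain ⟨C, hC⟩ := exists_forall_norm_caputo_le hab hαN hf
  have hsup : 0 ≤ supNormOn (caputoRight a b α f x) a x := supNormOn_nonneg
  have hpow : (x - y) ^ α ≤ (x - a) ^ α :=
    Real.rpow_le_rpow (sub_nonneg.2 hy.2) (sub_le_sub_left hy.1 x) hα.le
  refine (norm_sub_taylorWithinEval_le_of_caputoRight hα hαN hf hx hy fun t ht =>
    norm_le_supNormOn (hC x hx).1 ⟨hy.1.trans ht.1, ht.2⟩).trans ?_
  gcongr

theorem norm_sub_taylorWithinEval_le_modCont_caputoLeft [CompleteSpace X] (hab : a < b)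
    (hα : 0 < α) (hαN : α < ⌈α⌉₊) (hf : ContDiffOn ℝ (⌈α⌉₊ : ℕ) f (Icc a b)) (hx : x ∈ Icc a b)
    (hy : y ∈ Icc x b) (hδ : y - x ≤ δ) :
    ‖f y - taylorWithinEval f (⌈α⌉₊ - 1) (Icc a b) x y‖
      ≤ modCont (caputoLeft a b α f x) δ x b * δ ^ α / Real.Gamma (α + 1) := by
  obtain ⟨C, hC⟩ := exists_forall_norm_caputo_le hab hαN hf
  have hω : 0 ≤ modCont (caputoLeft a b α f x) δ x b := modCont_nonneg
  have hpow : (y - x) ^ α ≤ δ ^ α := Real.rpow_le_rpow (sub_nonneg.2 hy.1) hδ hα.le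
  refine (norm_sub_taylorWithinEval_le_of_caputoLeft hα hαN hf hx hy fun t ht => ?_).trans
    (by gcongr)
  rw [← sub_zero (caputoLeft a b α f x t), ← caputoLeft_self (x := x)]
  refine norm_sub_le_modCont (hC x hx).2 ⟨ht.1, ht.2.trans hy.2⟩ ⟨le_rfl, hx.2⟩ ?_
  rw [abs_of_nonneg (sub_nonneg.2 ht.1)]
  exact (sub_le_sub_right ht.2 x).trans hδ

theorem norm_sub_taylorWithinEval_le_modCont_caputoRight [CompleteSpace X] (hab : a < b)
    (hα : 0 < α) (hαN : α < ⌈α⌉₊) (hf : ContDiffOn ℝ (⌈α⌉₊ : ℕ) f (Icc a b)) (hx : x ∈ Icc a b)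
    (hy : y ∈ Icc a x) (hδ : x - y ≤ δ) :
    ‖f y - taylorWithinEval f (⌈α⌉₊ - 1) (Icc a b) x y‖
      ≤ modCont (caputoRight a b α f x) δ a x * δ ^ α / Real.Gamma (α + 1) := by
  obtain ⟨C, hC⟩ := exists_forall_norm_caputo_le hab hαN hf
  have hω : 0 ≤ modCont (caputoRight a b α f x) δ a x := modCont_nonneg
  have hpow : (x - y) ^ α ≤ δ ^ α := Real.rpow_le_rpow (sub_nonneg.2 hy.2) hδ hα.le
  refine (norm_sub_taylorWithinEval_le_of_caputoRight hα hαN hf hx hy fun t ht => ?_).trans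
    (by gcongr)
  rw [← sub_zero (caputoRight a b α f x t), ← caputoRight_self (x := x)]
  refine norm_sub_le_modCont (hC x hx).1 ⟨hy.1.trans ht.1, ht.2⟩ ⟨hx.1, le_rfl⟩ ?_
  rw [abs_sub_comm, abs_of_nonneg (sub_nonneg.2 ht.2)]
  exact (sub_le_sub_left ht.1 x).trans hδ

theorem norm_sub_taylorWithinEval_le_modCont_add_modCont [CompleteSpace X] (hab : a < b)
    (hα : 0 < α) (hαN : α < ⌈α⌉₊) (hf : ContDiffOn ℝ (⌈α⌉₊ : ℕ) f (Icc a b)) (hx : x ∈ Icc a b)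
    (hy : y ∈ Icc a b) (hδ : |y - x| ≤ δ) :
    ‖f y - taylorWithinEval f (⌈α⌉₊ - 1) (Icc a b) x y‖
      ≤ (modCont (caputoRight a b α f x) δ a x + modCont (caputoLeft a b α f x) δ x b)
          * δ ^ α / Real.Gamma (α + 1) := by
  have hpow : 0 ≤ δ ^ α := Real.rpow_nonneg ((abs_nonneg _).trans hδ) α
  obtain ⟨hδleft, hδright⟩ := abs_sub_le_iff.1 hδ
  rcases le_total x y with hxy | hyx
  · refine (norm_sub_taylorWithinEval_le_modCont_caputoLeft hab hα hαN hf hx ⟨hxy, hy.2⟩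
      hδleft).trans ?_
    gcongr
    exact le_add_of_nonneg_left modCont_nonneg
  · refine (norm_sub_taylorWithinEval_le_modCont_caputoRight hab hα hαN hf hx ⟨hy.1, hyx⟩
      hδright).trans ?_
    gcongr
    exact le_add_of_nonneg_right modCont_nonneg

end CaputoTaylor

section Bounds

open Set

variable {X : Type*} [NormedAddCommGroup X] [NormedSpace ℝ X] {a b α β : ℝ} {f : ℝ → X}
  {m n : ℕ} {x : ℝ}

/-- The contribution of the Taylor terms of orders `1, …, N` to the error bounds on an interval of
length `L`, where `c j` bounds the norm of the `j`-th derivative: `c j = ‖f^{(j)}(x)‖` in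
`pointBound` and `c j = ‖f^{(j)}‖_∞` in `unifBound`. -/
noncomputable def taylorTerm (L β : ℝ) (m N : ℕ) (c : ℕ → ℝ) (n : ℕ) : ℝ :=
  ∑ j ∈ Finset.Icc 1 N, c j / (j ! : ℝ) * (1 / (n : ℝ) ^ (β * (j : ℝ))
    + L ^ j / (4 * (m : ℝ) * ((n : ℝ) ^ (1 - β) - 2) ^ (2 * m)))

/-- The uniform counterpart of `fracTerm` occurring in `unifBound`: moduli of continuity and sup
norms are replaced by their suprema over the base point, interval lengths by `b - a`. -/
noncomputable def unifFracTerm (a b α β : ℝ) (m : ℕ) (f : ℝ → X) (n : ℕ) : ℝ :=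
  ((⨆ x : Icc a b, modCont (caputoRight a b α f x) (1 / (n : ℝ) ^ β) a x)
      + (⨆ x : Icc a b, modCont (caputoLeft a b α f x) (1 / (n : ℝ) ^ β) x b)) / (n : ℝ) ^ (α * β)
    + (b - a) ^ α / (4 * (m : ℝ) * ((n : ℝ) ^ (1 - β) - 2) ^ (2 * m))
      * ((⨆ x : Icc a b, supNormOn (caputoRight a b α f x) a x)
        + (⨆ x : Icc a b, supNormOn (caputoLeft a b α f x) x b))

theorem pointBound_eq (a b α β : ℝ) (m : ℕ) (f : ℝ → X) (n : ℕ) (x : ℝ) :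
    pointBound a b α β m f n x = 2 * (1 + 4 ^ m : ℝ) ^ (1 / (2 * (m : ℝ))) *
      (taylorTerm (b - a) β m (⌈α⌉₊ - 1) (fun j => ‖iteratedDerivWithin j f (Icc a b) x‖) n
        + 1 / Real.Gamma (α + 1) * fracTerm a b α β m f n x) :=
  rfl

theorem unifBound_eq (a b α β : ℝ) (m : ℕ) (f : ℝ → X) (n : ℕ) :
    unifBound a b α β m f n = 2 * (1 + 4 ^ m : ℝ) ^ (1 / (2 * (m : ℝ))) *
      (taylorTerm (b - a) β m (⌈α⌉₊ - 1)
          (fun j => supNormOn (iteratedDerivWithin j f (Icc a b)) a b) n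
        + 1 / Real.Gamma (α + 1) * unifFracTerm a b α β m f n) :=
  rfl

theorem tail_nonneg {r : ℝ} (hr : 0 ≤ r) (m n : ℕ) (β : ℝ) :
    0 ≤ r / (4 * (m : ℝ) * ((n : ℝ) ^ (1 - β) - 2) ^ (2 * m)) :=
  div_nonneg hr (mul_nonneg (by positivity) ((even_two_mul m).pow_nonneg _))

theorem taylorTerm_mono {L : ℝ} (hL : 0 ≤ L) {N : ℕ} {c d : ℕ → ℝ}
    (hcd : ∀ j ∈ Finset.Icc 1 N, c j ≤ d j) :
    taylorTerm L β m N c n ≤ taylorTerm L β m N d n := by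
  refine Finset.sum_le_sum fun j hj => ?_
  have htail := tail_nonneg (pow_nonneg hL j) m n β
  gcongr
  exact hcd j hj

theorem taylorTerm_nonneg {L : ℝ} (hL : 0 ≤ L) {N : ℕ} {c : ℕ → ℝ} (hc : ∀ j, 0 ≤ c j) :
    0 ≤ taylorTerm L β m N c n :=
  Finset.sum_nonneg fun j _ => mul_nonneg (div_nonneg (hc j) (by positivity))
    (add_nonneg (by positivity) (tail_nonneg (pow_nonneg hL j) m n β))

theorem fracTerm_nonneg (hx : x ∈ Icc a b) : 0 ≤ fracTerm a b α β m f n x :=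
  add_nonneg (div_nonneg (add_nonneg modCont_nonneg modCont_nonneg) (by positivity))
    (mul_nonneg (tail_nonneg zero_le_one m n β)
      (add_nonneg (mul_nonneg supNormOn_nonneg (Real.rpow_nonneg (sub_nonneg.2 hx.1) α))
        (mul_nonneg supNormOn_nonneg (Real.rpow_nonneg (sub_nonneg.2 hx.2) α))))

theorem pointBound_nonneg (hα : 0 < α) (hx : x ∈ Icc a b) : 0 ≤ pointBound a b α β m f n x := by
  have hfrac := fracTerm_nonneg (α := α) (β := β) (m := m) (f := f) (n := n) hx
  have htaylor := taylorTerm_nonneg (β := β) (m := m) (n := n) (N := ⌈α⌉₊ - 1)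
    (sub_nonneg.2 (hx.1.trans hx.2)) fun j => norm_nonneg (iteratedDerivWithin j f (Icc a b) x)
  rw [pointBound_eq]
  positivity

theorem fracTerm_le_unifFracTerm (hab : a < b) (hα : 0 < α) (hαN : α < ⌈α⌉₊)
    (hf : ContDiffOn ℝ (⌈α⌉₊ : ℕ) f (Icc a b)) (hx : x ∈ Icc a b) :
    fracTerm a b α β m f n x ≤ unifFracTerm a b α β m f n := by
  obtain ⟨C, hC⟩ := exists_forall_norm_caputo_le hab hαN hf
  have hleft : ∀ z : Icc a b, a ≤ z := fun z => z.2.1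
  have hright : ∀ z : Icc a b, z ≤ b := fun z => z.2.2
  have hωR := modCont_le_iSup (δ := 1 / (n : ℝ) ^ β) hleft (fun z => (hC z z.2).1) ⟨x, hx⟩
  have hωL := modCont_le_iSup (δ := 1 / (n : ℝ) ^ β) hright (fun z => (hC z z.2).2) ⟨x, hx⟩
  have hsupR := supNormOn_le_iSup hleft (fun z => (hC z z.2).1) ⟨x, hx⟩
  have hsupL := supNormOn_le_iSup hright (fun z => (hC z z.2).2) ⟨x, hx⟩
  have hpowR : (x - a) ^ α ≤ (b - a) ^ α :=
    Real.rpow_le_rpow (sub_nonneg.2 hx.1) (sub_le_sub_right hx.2 a) hα.le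
  have hpowL : (b - x) ^ α ≤ (b - a) ^ α :=
    Real.rpow_le_rpow (sub_nonneg.2 hx.2) (sub_le_sub_left hx.1 b) hα.le
  have hrearrange : ∀ q s t : ℝ,
      (b - a) ^ α / q * (s + t) = 1 / q * (s * (b - a) ^ α + t * (b - a) ^ α) := fun _ _ _ => by
    ring
  rw [fracTerm, unifFracTerm, hrearrange]
  exact add_le_add (div_le_div_of_nonneg_right (add_le_add hωR hωL) (by positivity))
    (mul_le_mul_of_nonneg_left (add_le_add
      (mul_le_mul hsupR hpowR (Real.rpow_nonneg (sub_nonneg.2 hx.1) α)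
        (supNormOn_nonneg.trans hsupR))
      (mul_le_mul hsupL hpowL (Real.rpow_nonneg (sub_nonneg.2 hx.2) α)
        (supNormOn_nonneg.trans hsupL))) (tail_nonneg zero_le_one m n β))

theorem norm_iteratedDerivWithin_le_supNormOn {N : ℕ} (hab : a < b)
    (hf : ContDiffOn ℝ N f (Icc a b)) {j : ℕ} (hj : j ≤ N) (hx : x ∈ Icc a b) :
    ‖iteratedDerivWithin j f (Icc a b) x‖ ≤ supNormOn (iteratedDerivWithin j f (Icc a b)) a b := by
  obtain ⟨M, hM⟩ := isCompact_Icc.exists_bound_of_continuousOn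
    (hf.continuousOn_iteratedDerivWithin (by exact_mod_cast hj) (uniqueDiffOn_Icc hab))
  exact norm_le_supNormOn hM hx

theorem pointBound_le_unifBound (hab : a < b) (hα : 0 < α) (hαN : α < ⌈α⌉₊)
    (hf : ContDiffOn ℝ (⌈α⌉₊ : ℕ) f (Icc a b)) (hx : x ∈ Icc a b) :
    pointBound a b α β m f n x ≤ unifBound a b α β m f n := by
  rw [pointBound_eq, unifBound_eq]
  gcongr
  · exact taylorTerm_mono (sub_pos.2 hab).le fun j hj =>
      norm_iteratedDerivWithin_le_supNormOn hab hf ((Finset.mem_Icc.1 hj).2.trans (Nat.sub_le _ _))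
        hx
  · exact fracTerm_le_unifFracTerm hab hα hαN hf hx

theorem tendsto_one_div_natCast_rpow {r : ℝ} (hr : 0 < r) :
    Tendsto (fun n : ℕ => 1 / (n : ℝ) ^ r) atTop (𝓝 0) :=
  tendsto_const_nhds.div_atTop ((tendsto_rpow_atTop hr).comp tendsto_natCast_atTop_atTop)

theorem tendsto_tail (hβ : β < 1) (hm : 1 ≤ m) (r : ℝ) :
    Tendsto (fun n : ℕ => r / (4 * (m : ℝ) * ((n : ℝ) ^ (1 - β) - 2) ^ (2 * m))) atTop (𝓝 0) := by
  have hgap : Tendsto (fun n : ℕ => (n : ℝ) ^ (1 - β) - 2) atTop atTop :=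
    tendsto_atTop_add_const_right _ (-2)
      ((tendsto_rpow_atTop (sub_pos.2 hβ)).comp tendsto_natCast_atTop_atTop)
  exact tendsto_const_nhds.div_atTop
    (((tendsto_pow_atTop (by omega)).comp hgap).const_mul_atTop (by positivity))

theorem tendsto_taylorTerm (hβ0 : 0 < β) (hβ1 : β < 1) (hm : 1 ≤ m) (L : ℝ) (N : ℕ) (c : ℕ → ℝ) :
    Tendsto (taylorTerm L β m N c) atTop (𝓝 0) := by
  refine (tendsto_finsetSum (a := fun _ => (0 : ℝ)) _ fun j hj => ?_).trans_eq (by simp)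
  have hj0 : (0 : ℝ) < j := by exact_mod_cast (Finset.mem_Icc.1 hj).1
  simpa using ((tendsto_one_div_natCast_rpow (mul_pos hβ0 hj0)).add
    (tendsto_tail hβ1 hm (L ^ j))).const_mul (c j / (j ! : ℝ))

theorem tendsto_unifFracTerm (hab : a < b) (hα : 0 < α) (hαN : α < ⌈α⌉₊)
    (hf : ContDiffOn ℝ (⌈α⌉₊ : ℕ) f (Icc a b)) (hβ0 : 0 < β) (hβ1 : β < 1) (hm : 1 ≤ m) :
    Tendsto (unifFracTerm a b α β m f) atTop (𝓝 0) := by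
  obtain ⟨C, hC⟩ := exists_forall_norm_caputo_le hab hαN hf
  have : Nonempty (Icc a b) := (nonempty_Icc.2 hab.le).to_subtype
  have hmod : Tendsto (fun n : ℕ =>
      ((⨆ x : Icc a b, modCont (caputoRight a b α f x) (1 / (n : ℝ) ^ β) a x)
        + (⨆ x : Icc a b, modCont (caputoLeft a b α f x) (1 / (n : ℝ) ^ β) x b))
        / (n : ℝ) ^ (α * β)) atTop (𝓝 0) := by
    refine squeeze_zero (fun n => ?_) (fun n => ?_) ((mul_zero (2 * C + 2 * C)) ▸
      (tendsto_one_div_natCast_rpow (mul_pos hα hβ0)).const_mul (2 * C + 2 * C))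
    · exact div_nonneg (add_nonneg (Real.iSup_nonneg fun _ => modCont_nonneg)
        (Real.iSup_nonneg fun _ => modCont_nonneg)) (by positivity)
    · rw [mul_one_div]
      gcongr
      · exact iSup_modCont_le (fun z : Icc a b => z.2.1) fun z => (hC z z.2).1
      · exact iSup_modCont_le (fun z : Icc a b => z.2.2) fun z => (hC z z.2).2
  have hsup := (tendsto_tail hβ1 hm ((b - a) ^ α)).mul_const
    ((⨆ x : Icc a b, supNormOn (caputoRight a b α f x) a x)
      + (⨆ x : Icc a b, supNormOn (caputoLeft a b α f x) x b))
  exact (hmod.add hsup).trans_eq (by rw [zero_mul, add_zero])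

theorem tendsto_unifBound (hab : a < b) (hα : 0 < α) (hαN : α < ⌈α⌉₊)
    (hf : ContDiffOn ℝ (⌈α⌉₊ : ℕ) f (Icc a b)) (hβ0 : 0 < β) (hβ1 : β < 1) (hm : 1 ≤ m) :
    Tendsto (unifBound a b α β m f) atTop (𝓝 0) := by
  have htaylor := tendsto_taylorTerm hβ0 hβ1 hm (b - a) (⌈α⌉₊ - 1)
    fun j => supNormOn (iteratedDerivWithin j f (Icc a b)) a b
  have hfrac := (tendsto_unifFracTerm hab hα hαN hf hβ0 hβ1 hm).const_mul (1 / Real.Gamma (α + 1))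
  exact ((htaylor.add hfrac).const_mul (2 * (1 + 4 ^ m : ℝ) ^ (1 / (2 * (m : ℝ))))).trans_eq
    (by rw [mul_zero, add_zero, mul_zero])

theorem tendsto_pointBound (hab : a < b) (hα : 0 < α) (hαN : α < ⌈α⌉₊)
    (hf : ContDiffOn ℝ (⌈α⌉₊ : ℕ) f (Icc a b)) (hβ0 : 0 < β) (hβ1 : β < 1) (hm : 1 ≤ m)
    (hx : x ∈ Icc a b) : Tendsto (fun n : ℕ => pointBound a b α β m f n x) atTop (𝓝 0) :=
  squeeze_zero (fun _ => pointBound_nonneg hα hx)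
    (fun _ => pointBound_le_unifBound hab hα hαN hf hx) (tendsto_unifBound hab hα hαN hf hβ0 hβ1 hm)

end Bounds

section Approximation

open Set

variable {X : Type*} [NormedAddCommGroup X] [NormedSpace ℝ X] {a b α β : ℝ}
  {f : ℝ → X} {m n : ℕ} {x : ℝ}

theorem norm_neuralOp_sub_taylor_le [CompleteSpace X] (hab : a < b) (hα : 0 < α)
    (hαN : α < ⌈α⌉₊) (hf : ContDiffOn ℝ (⌈α⌉₊ : ℕ) f (Icc a b)) (hβ : β < 1) (hm : 1 ≤ m)
    (hn : 2 < (n : ℝ) ^ (1 - β)) (hnab : ⌈(n : ℝ) * a⌉ ≤ ⌊(n : ℝ) * b⌋) (hx : x ∈ Icc a b) :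
    ‖neuralOp m a b n f x
        - (∑ j ∈ Finset.Icc 1 (⌈α⌉₊ - 1),
            neuralOp m a b n (fun t : ℝ => (t - x) ^ j) x •
              ((1 / (j ! : ℝ)) • iteratedDerivWithin j f (Icc a b) x))
        - f x‖
      ≤ 2 * (1 + 4 ^ m : ℝ) ^ (1 / (2 * (m : ℝ))) / Real.Gamma (α + 1)
          * fracTerm a b α β m f n x := by
  have hδα : (1 / (n : ℝ) ^ β) ^ α = 1 / (n : ℝ) ^ (α * β) := by
    rw [Real.div_rpow zero_le_one (by positivity), Real.one_rpow, ← Real.rpow_mul n.cast_nonneg,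
      mul_comm]
  rw [← neuralOp_sub_taylorWithinEval hm hnab hx]
  refine (norm_neuralOp_le_of_two_lt_rpow hm hβ hn hnab hx
    (fun _ hy hyx => norm_sub_taylorWithinEval_le_modCont_add_modCont hab hα hαN hf hx hy hyx)
    (fun _ hy => norm_sub_taylorWithinEval_le_supNormOn_caputoRight hab hα hαN hf hx hy)
    (fun _ hy => norm_sub_taylorWithinEval_le_supNormOn_caputoLeft hab hα hαN hf hx hy)).trans_eq ?_
  rw [fracTerm, hδα]
  ring

theorem norm_neuralOp_sub_le_of_iteratedDerivWithin_eq_zero [CompleteSpace X] (hab : a < b)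
    (hα : 0 < α) (hαN : α < ⌈α⌉₊) (hf : ContDiffOn ℝ (⌈α⌉₊ : ℕ) f (Icc a b)) (hβ : β < 1)
    (hm : 1 ≤ m) (hn : 2 < (n : ℝ) ^ (1 - β)) (hnab : ⌈(n : ℝ) * a⌉ ≤ ⌊(n : ℝ) * b⌋)
    (hx : x ∈ Icc a b)
    (hzero : ∀ j ∈ Finset.Icc 1 (⌈α⌉₊ - 1), iteratedDerivWithin j f (Icc a b) x = 0) :
    ‖neuralOp m a b n f x - f x‖
      ≤ 2 * (1 + 4 ^ m : ℝ) ^ (1 / (2 * (m : ℝ))) / Real.Gamma (α + 1)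
          * fracTerm a b α β m f n x := by
  have htaylor := norm_neuralOp_sub_taylor_le hab hα hαN hf hβ hm hn hnab hx
  rwa [Finset.sum_eq_zero fun j hj => by rw [hzero j hj, smul_zero, smul_zero], sub_zero]
    at htaylor

theorem norm_sum_neuralOp_smul_iteratedDerivWithin_le (hβ : β < 1) (hm : 1 ≤ m)
    (hn : 2 < (n : ℝ) ^ (1 - β)) (hnab : ⌈(n : ℝ) * a⌉ ≤ ⌊(n : ℝ) * b⌋) (hx : x ∈ Icc a b)
    (f : ℝ → X) (N : ℕ) (s : Set ℝ) :
    ‖∑ j ∈ Finset.Icc 1 N, neuralOp m a b n (fun t : ℝ => (t - x) ^ j) x •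
        ((1 / (j ! : ℝ)) • iteratedDerivWithin j f s x)‖
      ≤ 2 * (1 + 4 ^ m : ℝ) ^ (1 / (2 * (m : ℝ)))
          * taylorTerm (b - a) β m N (fun j => ‖iteratedDerivWithin j f s x‖) n := by
  rw [taylorTerm, Finset.mul_sum]
  refine norm_sum_le_of_le _ fun j hj => ?_
  rw [norm_smul, norm_smul, Real.norm_of_nonneg (show 0 ≤ 1 / (j ! : ℝ) by positivity)]
  refine (mul_le_mul_of_nonneg_right (norm_neuralOp_sub_pow_le hm hβ hn hnab hx
    (Finset.mem_Icc.1 hj).1) (by positivity)).trans_eq ?_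
  ring

theorem norm_neuralOp_sub_le_pointBound [CompleteSpace X] (hab : a < b) (hα : 0 < α)
    (hαN : α < ⌈α⌉₊) (hf : ContDiffOn ℝ (⌈α⌉₊ : ℕ) f (Icc a b)) (hβ : β < 1) (hm : 1 ≤ m)
    (hn : 2 < (n : ℝ) ^ (1 - β)) (hnab : ⌈(n : ℝ) * a⌉ ≤ ⌊(n : ℝ) * b⌋) (hx : x ∈ Icc a b) :
    ‖neuralOp m a b n f x - f x‖ ≤ pointBound a b α β m f n x := by
  have hfrac := norm_neuralOp_sub_taylor_le hab hα hαN hf hβ hm hn hnab hx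
  have htaylor := norm_sum_neuralOp_smul_iteratedDerivWithin_le hβ hm hn hnab hx f (⌈α⌉₊ - 1)
    (Icc a b)
  rw [sub_right_comm] at hfrac
  refine (norm_le_norm_sub_add _ _).trans ((add_le_add hfrac htaylor).trans_eq ?_)
  rw [pointBound_eq]
  ring

theorem norm_neuralOp_sub_le_unifBound [CompleteSpace X] (hab : a < b) (hα : 0 < α)
    (hαN : α < ⌈α⌉₊) (hf : ContDiffOn ℝ (⌈α⌉₊ : ℕ) f (Icc a b)) (hβ : β < 1) (hm : 1 ≤ m)
    (hn : 2 < (n : ℝ) ^ (1 - β)) (hnab : ⌈(n : ℝ) * a⌉ ≤ ⌊(n : ℝ) * b⌋) (hx : x ∈ Icc a b) :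
    ‖neuralOp m a b n f x - f x‖ ≤ unifBound a b α β m f n :=
  (norm_neuralOp_sub_le_pointBound hab hα hαN hf hβ hm hn hnab hx).trans
    (pointBound_le_unifBound hab hα hαN hf hx)

theorem eventually_two_lt_rpow (hβ : β < 1) : ∀ᶠ n : ℕ in atTop, 2 < (n : ℝ) ^ (1 - β) :=
  ((tendsto_rpow_atTop (sub_pos.2 hβ)).comp tendsto_natCast_atTop_atTop).eventually_gt_atTop 2

theorem eventually_ceil_le_floor (hab : a < b) :
    ∀ᶠ n : ℕ in atTop, ⌈(n : ℝ) * a⌉ ≤ ⌊(n : ℝ) * b⌋ := by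
  filter_upwards [(tendsto_natCast_atTop_atTop (R := ℝ)).eventually_ge_atTop (1 / (b - a))]
    with n hn
  rw [div_le_iff₀ (sub_pos.2 hab)] at hn
  exact Int.le_floor.2 (by linarith [Int.ceil_lt_add_one ((n : ℝ) * a)])

theorem tendstoUniformlyOn_neuralOp [CompleteSpace X] (hab : a < b) (hα : 0 < α)
    (hαN : α < ⌈α⌉₊) (hf : ContDiffOn ℝ (⌈α⌉₊ : ℕ) f (Icc a b)) (hβ0 : 0 < β) (hβ1 : β < 1)
    (hm : 1 ≤ m) :
    TendstoUniformlyOn (fun (n : ℕ) (x : ℝ) => neuralOp m a b n f x) f atTop (Icc a b) := by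
  rw [Metric.tendstoUniformlyOn_iff]
  intro ε hε
  filter_upwards [eventually_two_lt_rpow hβ1, eventually_ceil_le_floor hab,
    (tendsto_unifBound hab hα hαN hf hβ0 hβ1 hm).eventually_lt_const hε] with n hn hnab hlt x hx
  rw [dist_comm, dist_eq_norm]
  exact (norm_neuralOp_sub_le_unifBound hab hα hαN hf hβ1 hm hn hnab hx).trans_lt hlt

end Approximation

theorem theorem30 {X : Type*} [NormedAddCommGroup X] [NormedSpace ℝ X] [CompleteSpace X]
    (a b : ℝ) (hab : a < b) (α : ℝ) (hα : 0 < α) (hαN : ∀ k : ℕ, α ≠ (k : ℝ))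
    (f : ℝ → X) (hf : ContDiffOn ℝ (⌈α⌉₊ : ℕ) f (Set.Icc a b))
    (β : ℝ) (hβ0 : 0 < β) (hβ1 : β < 1) (m : ℕ) (hm : 1 ≤ m) :
    -- the fractional derivatives are bounded uniformly in the base point
    (∃ C : ℝ, ∀ x ∈ Set.Icc a b,
      (∀ y ∈ Set.Icc a x, ‖caputoRight a b α f x y‖ ≤ C) ∧
      (∀ y ∈ Set.Icc x b, ‖caputoLeft a b α f x y‖ ≤ C)) ∧
    -- the error estimates
    (∀ n : ℕ, 2 < (n : ℝ) ^ (1 - β) → ⌈(n : ℝ) * a⌉ ≤ ⌊(n : ℝ) * b⌋ →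
      (∀ x ∈ Set.Icc a b,
        ‖neuralOp m a b n f x
            - (∑ j ∈ Finset.Icc 1 (⌈α⌉₊ - 1),
                neuralOp m a b n (fun t : ℝ => (t - x) ^ j) x •
                  ((1 / (j ! : ℝ)) • iteratedDerivWithin j f (Set.Icc a b) x))
            - f x‖
          ≤ 2 * (1 + 4 ^ m : ℝ) ^ (1 / (2 * (m : ℝ))) / Real.Gamma (α + 1)
              * fracTerm a b α β m f n x) ∧
      (∀ x ∈ Set.Icc a b,
        (∀ j ∈ Finset.Icc 1 (⌈α⌉₊ - 1), iteratedDerivWithin j f (Set.Icc a b) x = 0) →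
        ‖neuralOp m a b n f x - f x‖
          ≤ 2 * (1 + 4 ^ m : ℝ) ^ (1 / (2 * (m : ℝ))) / Real.Gamma (α + 1)
              * fracTerm a b α β m f n x) ∧
      (∀ x ∈ Set.Icc a b, ‖neuralOp m a b n f x - f x‖ ≤ pointBound a b α β m f n x) ∧
      BddAbove ((fun x => ‖neuralOp m a b n f x - f x‖) '' Set.Icc a b) ∧
      supNormOn (fun x => neuralOp m a b n f x - f x) a b ≤ unifBound a b α β m f n) ∧
    -- pointwise and uniform convergence, with the above rates
    (∀ x ∈ Set.Icc a b,
      Tendsto (fun n : ℕ => pointBound a b α β m f n x) atTop (𝓝 0) ∧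
      Tendsto (fun n : ℕ => neuralOp m a b n f x) atTop (𝓝 (f x))) ∧
    Tendsto (fun n : ℕ => unifBound a b α β m f n) atTop (𝓝 0) ∧
    TendstoUniformlyOn (fun (n : ℕ) (x : ℝ) => neuralOp m a b n f x) f atTop (Set.Icc a b) := by
  have hαN' : α < ⌈α⌉₊ := (Nat.le_ceil α).lt_of_ne (hαN _)
  have hunif := tendstoUniformlyOn_neuralOp hab hα hαN' hf hβ0 hβ1 hm
  refine ⟨exists_forall_norm_caputo_le hab hαN' hf, fun n hn hnab => ?_, fun x hx =>
    ⟨tendsto_pointBound hab hα hαN' hf hβ0 hβ1 hm hx, hunif.tendsto_at hx⟩,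
    tendsto_unifBound hab hα hαN' hf hβ0 hβ1 hm, hunif⟩
  have herror : ∀ x ∈ Set.Icc a b, ‖neuralOp m a b n f x - f x‖ ≤ unifBound a b α β m f n :=
    fun x hx => norm_neuralOp_sub_le_unifBound hab hα hαN' hf hβ1 hm hn hnab hx
  exact ⟨fun x hx => norm_neuralOp_sub_taylor_le hab hα hαN' hf hβ1 hm hn hnab hx,
    fun x hx hzero => norm_neuralOp_sub_le_of_iteratedDerivWithin_eq_zero hab hα hαN' hf hβ1 hm hn
      hnab hx hzero,
    fun x hx => norm_neuralOp_sub_le_pointBound hab hα hαN' hf hβ1 hm hn hnab hx,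
    bddAbove_norm_image herror, supNormOn_le hab.le herror⟩
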